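/- Let $R$ be a ring. Give the category $\mathrm{Ch}_{\geq 0}(R)$ of non-negatively graded chain complexes of left $R$-modules the Hurewicz classes of maps: weak equivalences are the chain homotopy equivalences, cofibrations are the degreewise split monomorphisms, and fibrations are the maps that are split epimorphisms in every positive degree (no condition in degree $0$). Transport these classes to the category $\mathrm{sMod}_R$ of simplicial left $R$-modules along the Dold--Kan equivalence: a map $f$ of $\mathrm{sMod}_R$ is a Hurewicz weak equivalence, cofibration or fibration if its normalization $N(f)$ is one in $\mathrm{Ch}_{\geq 0}(R)$. The Hurewicz classes on simplicial abelian groups $\mathrm{sAb}$ are defined in the same way. Then: 0. The Hurewicz classes make $\mathrm{Ch}_{\geq 0}(R)$ and $\mathrm{sMod}_R$ into model categories (with all small limits and colimits). 1. If $R$ is commutative, then $\mathrm{sMod}_R$ with the Hurewicz model structure and the closed symmetric monoidal structure given by the degreewise tensor product $(A\otimes B)_n = A_n\otimes_R B_n$ is a monoidal model category. That is, for cofibrations $i\colon X\to Y$ and $k\colon V\to W$ the pushout-product $$i\,\square\, k\colon (X\otimes W)\amalg_{X\otimes V}(Y\otimes V)\to Y\otimes W$$ is a cofibration, which is a weak equivalence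 if $i$ or $k$ is; and for every cofibrant $X$ and every weak equivalence $q\colon Q\to \mathbb 1$ with $Q$ cofibrant and $\mathbb 1$ the tensor unit, the composite $X\otimes Q\to X\otimes \mathbb 1\cong X$ is a weak equivalence. 2. For arbitrary $R$, $\mathrm{sMod}_R$ with the Hurewicz model structure is an $\mathrm{sAb}$-enriched model category. That is, $\mathrm{sAb}$ with its Hurewicz model structure and degreewise tensor product over $\mathbb Z$ is a monoidal model category; the category $\mathrm{sMod}_R$, enriched over $\mathrm{sAb}$ by $\underline{\mathrm{Hom}}(A,B)_n = \mathrm{Hom}_{\mathrm{sMod}_R}(A\otimes \mathbb Z\Delta^n, B)$, is cotensored over $\mathrm{sAb}$ and is tensored over $\mathrm{sAb}$ by the degreewise tensor product $(A\otimes K)_n = A_n\otimes_{\mathbb Z}K_n$ with $R$ acting on $A_n$; and for $i$ a cofibration of $\mathrm{sMod}_R$ and $k$ a cofibration of $\mathrm{sAb}$ the map $i\,\square\, k$ is a cofibration of $\mathrm{sMod}_R$, which is a weak equivalence if $i$ or $k$ is; and for every cofibrant $X$ in $\mathrm{sMod}_R$ and every weak equivalence $q\colon Q\to\mathbb 1$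 in $\mathrm{sAb}$ with $Q$ cofibrant and $\mathbb 1$ the tensor unit of $\mathrm{sAb}$, the composite $X\otimes Q\to X\otimes\mathbb 1\cong X$ is a weak equivalence. -/

import Mathlib

universe v v₁ v₂ v₃ w u u₁ u₂ u₃

open CategoryTheory Category Limits MonoidalCategory Opposite

noncomputable section

/-! ### Model categories, monoidal model categories, enriched model categories -/

/-- Three distinguished classes of morphisms on a category. -/
structure ModelClasses (C : Type u) [Category.{v} C] where
  /-- the weak equivalences -/
  W : MorphismProperty C
  /-- the cofibrations -/
  cof : MorphismProperty C
  /-- the fibrations -/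
  fib : MorphismProperty C

namespace ModelClasses

/-- The three classes are the weak equivalences, cofibrations and fibrations of a (closed) model
structure, and the underlying category has all small limits and colimits. -/
structure IsModelCategory {C : Type u} [Category.{v} C] (D : ModelClasses C) : Prop where
  hasLimits : HasLimits C
  hasColimits : HasColimits C
  exists_modelCategory : ∃ M : HomotopicalAlgebra.ModelCategory C,
    M.categoryWithWeakEquivalences.weakEquivalences = D.W ∧
    M.categoryWithCofibrations.cofibrations = D.cof ∧
    M.categoryWithFibrations.fibrations = D.fib

/-- An object is cofibrant if the map from an initial object to it is a cofibration. -/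
def IsCofibrant {C : Type u} [Category.{v} C] (D : ModelClasses C) (X : C) : Prop :=
  ∀ (I : C) (hI : IsInitial I), D.cof (hI.to X)

/-- The pushout-product axiom for a bifunctor `F`. For `i : X ⟶ Y` and `k : V ⟶ W`, the map `sq.ι`
is the canonical map from the pushout of `F(Y, V) ⟵ F(X, V) ⟶ F(X, W)` to `F(Y, W)`. -/
structure PushoutProductAxiom {C₁ : Type u₁} [Category.{v₁} C₁] {C₂ : Type u₂} [Category.{v₂} C₂]
    {C₃ : Type u₃} [Category.{v₃} C₃] (D₁ : ModelClasses C₁) (D₂ : ModelClasses C₂)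
    (D₃ : ModelClasses C₃) (F : C₁ ⥤ C₂ ⥤ C₃) : Prop where
  cof : ∀ ⦃X Y : C₁⦄ (i : X ⟶ Y) ⦃V W : C₂⦄ (k : V ⟶ W) (sq : F.PushoutObjObj i k),
    D₁.cof i → D₂.cof k → D₃.cof sq.ι
  acyclic : ∀ ⦃X Y : C₁⦄ (i : X ⟶ Y) ⦃V W : C₂⦄ (k : V ⟶ W) (sq : F.PushoutObjObj i k),
    D₁.cof i → D₂.cof k → (D₁.W i ∨ D₂.W k) → D₃.W sq.ι

/-- A monoidal model category: a model category with a closed symmetric monoidal structure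
satisfying the pushout-product axiom and the unit axiom. -/
structure IsMonoidalModelCategory {C : Type u} [Category.{v} C] [MonoidalCategory C]
    [SymmetricCategory C] [MonoidalClosed C] (D : ModelClasses C) : Prop where
  isModelCategory : D.IsModelCategory
  pushoutProduct : PushoutProductAxiom D D D (curriedTensor C)
  unit : ∀ (X Q : C) (q : Q ⟶ 𝟙_ C), D.IsCofibrant X → D.IsCofibrant Q → D.W q →
    D.W (X ◁ q ≫ (ρ_ X).hom)

end ModelClasses

section Enriched

variable (V : Type u₁) [Category.{v₁} V] [MonoidalCategory V] [SymmetricCategory V]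
  [MonoidalClosed V] {C : Type u₂} [Category.{v₂} C] [EnrichedOrdinaryCategory V C]

/-- Given `η : K ⟶ Hom(A, T)`, the induced map `Hom(T, B) ⟶ [K, Hom(A, B)]` in `V`, natural in the
`V`-enriched sense in `B`. -/
def tensorComparison {K : V} {A T : C} (η : K ⟶ (A ⟶[V] T)) (B : C) :
    (T ⟶[V] B) ⟶ (ihom K).obj (A ⟶[V] B) :=
  MonoidalClosed.curry (η ▷ (T ⟶[V] B) ≫ eComp V A T B)

/-- Given `ε : K ⟶ Hom(P, B)`, the induced map `Hom(A, P) ⟶ [K, Hom(A, B)]` in `V`, natural in the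
`V`-enriched sense in `A`. -/
def cotensorComparison {K : V} {P B : C} (ε : K ⟶ (P ⟶[V] B)) (A : C) :
    (A ⟶[V] P) ⟶ (ihom K).obj (A ⟶[V] B) :=
  MonoidalClosed.curry ((β_ K (A ⟶[V] P)).hom ≫ (A ⟶[V] P) ◁ ε ≫ eComp V A P B)

/-- The `V`-category `C` is cotensored: every `K : V` and `B : C` have a cotensor `P = B ^ K`,
representing `A ↦ [K, Hom(A, B)]`. -/
def IsCotensored (C : Type u₂) [Category.{v₂} C] [EnrichedOrdinaryCategory V C] : Prop :=
  ∀ (K : V) (B : C), ∃ (P : C) (ε : K ⟶ (P ⟶[V] B)), ∀ A : C, IsIso (cotensorComparison V ε A)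

/-- The bifunctor `T : C ⥤ V ⥤ C`, written `(A, K) ↦ A ⊗ K`, is a tensoring of the `V`-category `C`:
there are maps `K ⟶ Hom(A, A ⊗ K)` compatible with the functoriality of `T` in both variables, which
induce isomorphisms `Hom(A ⊗ K, B) ≅ [K, Hom(A, B)]` in `V`. -/
structure Tensoring (T : C ⥤ V ⥤ C) where
  /-- the universal map `K ⟶ Hom(A, A ⊗ K)` -/
  η (A : C) (K : V) : K ⟶ (A ⟶[V] (T.obj A).obj K)
  naturality {K L : V} (A : C) (k : K ⟶ L) :
    k ≫ η A L = η A K ≫ eHomWhiskerLeft V A ((T.obj A).map k)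
  dinaturality {A A' : C} (f : A ⟶ A') (K : V) :
    η A K ≫ eHomWhiskerLeft V A ((T.map f).app K) =
      η A' K ≫ eHomWhiskerRight V f ((T.obj A').obj K)
  isIso_comparison (A : C) (K : V) (B : C) : IsIso (tensorComparison V (η A K) B)
  /-- the canonical isomorphism `A ⊗ 𝟙 ≅ A` -/
  ρ (A : C) : (T.obj A).obj (𝟙_ V) ≅ A
  η_ρ (A : C) : η A (𝟙_ V) ≫ eHomWhiskerLeft V A (ρ A).hom = eId V A

variable {V}

/-- A `V`-enriched model category, for a monoidal model category `V`: a tensored and cotensored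
`V`-category, with a model structure on the underlying category, satisfying the external
pushout-product axiom and the unit axiom. Here `t` is the tensoring. -/
structure ModelClasses.IsEnrichedModelCategory (DV : ModelClasses V) (DC : ModelClasses C)
    {T : C ⥤ V ⥤ C} (t : Tensoring V T) : Prop where
  base : DV.IsMonoidalModelCategory
  isModelCategory : DC.IsModelCategory
  isCotensored : IsCotensored V C
  pushoutProduct : ModelClasses.PushoutProductAxiom DC DV DC T
  unit : ∀ (X : C) (Q : V) (q : Q ⟶ 𝟙_ V), DC.IsCofibrant X → DV.IsCofibrant Q → DV.W q →
    DC.W ((T.obj X).map q ≫ (t.ρ X).hom)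

end Enriched

/-! ### The Hurewicz classes -/

section Hurewicz

variable (A : Type u) [Category.{v} A] [Abelian A]

/-- The Hurewicz classes on non-negatively graded chain complexes: chain homotopy equivalences,
degreewise split monomorphisms, and degreewise split epimorphisms in positive degrees. -/
def chainHurewicz : ModelClasses (ChainComplex A ℕ) where
  W := HomologicalComplex.homotopyEquivalences A (ComplexShape.down ℕ)
  cof _ _ f := ∀ n : ℕ, IsSplitMono (f.f n)
  fib _ _ f := ∀ n : ℕ, 0 < n → IsSplitEpi (f.f n)

/-- The Hurewicz classes on simplicial objects: those transported along the normalization functor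
of the Dold-Kan equivalence. -/
def simplicialHurewicz : ModelClasses (SimplicialObject A) where
  W := (chainHurewicz A).W.inverseImage (Abelian.DoldKan.equivalence (A := A)).functor
  cof := (chainHurewicz A).cof.inverseImage (Abelian.DoldKan.equivalence (A := A)).functor
  fib := (chainHurewicz A).fib.inverseImage (Abelian.DoldKan.equivalence (A := A)).functor

end Hurewicz

/-! ### Abelian groups as a closed symmetric monoidal category -/

namespace AbTensor

open scoped TensorProduct

instance : MonoidalCategoryStruct AddCommGrpCat.{u} where
  tensorObj M N := .of (M ⊗[ℤ] N)
  whiskerLeft M _ _ f := AddCommGrpCat.ofHom (f.hom.toIntLinearMap.lTensor M).toAddMonoidHom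
  whiskerRight f M := AddCommGrpCat.ofHom (f.hom.toIntLinearMap.rTensor M).toAddMonoidHom
  tensorHom f g := AddCommGrpCat.ofHom
    (TensorProduct.map f.hom.toIntLinearMap g.hom.toIntLinearMap).toAddMonoidHom
  tensorUnit := .of (ULift.{u} ℤ)
  associator M N K := (TensorProduct.assoc ℤ M N K).toAddEquiv.toAddCommGrpIso
  leftUnitor M := ((TensorProduct.congr ULift.moduleEquiv (LinearEquiv.refl ℤ M)).trans
    (TensorProduct.lid ℤ M)).toAddEquiv.toAddCommGrpIso
  rightUnitor M := ((TensorProduct.congr (LinearEquiv.refl ℤ M) ULift.moduleEquiv).trans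
    (TensorProduct.rid ℤ M)).toAddEquiv.toAddCommGrpIso

/-- Maps out of a tensor product agree if they agree on pure tensors. -/
theorem hom_ext {M N : AddCommGrpCat.{u}} {P : AddCommGrpCat.{u}} {f g : M ⊗ N ⟶ P}
    (h : ∀ (m : M) (n : N), f.hom (m ⊗ₜ[ℤ] n) = g.hom (m ⊗ₜ[ℤ] n)) : f = g := by
  ext x
  exact DFunLike.congr_fun (TensorProduct.ext' (g := f.hom.toIntLinearMap)
    (h := g.hom.toIntLinearMap) h) x

theorem hom_ext₃ {M N K : AddCommGrpCat.{u}} {P : AddCommGrpCat.{u}} {f g : (M ⊗ N) ⊗ K ⟶ P}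
    (h : ∀ (m : M) (n : N) (k : K),
      f.hom ((m ⊗ₜ[ℤ] n) ⊗ₜ[ℤ] k) = g.hom ((m ⊗ₜ[ℤ] n) ⊗ₜ[ℤ] k)) : f = g := by
  ext x
  exact DFunLike.congr_fun (TensorProduct.ext_threefold (g := f.hom.toIntLinearMap)
    (h := g.hom.toIntLinearMap) h) x

theorem hom_ext₃' {M N K : AddCommGrpCat.{u}} {P : AddCommGrpCat.{u}} {f g : M ⊗ (N ⊗ K) ⟶ P}
    (h : ∀ (m : M) (n : N) (k : K),
      f.hom (m ⊗ₜ[ℤ] (n ⊗ₜ[ℤ] k)) = g.hom (m ⊗ₜ[ℤ] (n ⊗ₜ[ℤ] k))) : f = g := by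
  let a : (M ⊗ N) ⊗ K ⟶ M ⊗ (N ⊗ K) := (TensorProduct.assoc ℤ M N K).toAddEquiv.toAddCommGrpIso.hom
  have : Epi a := inferInstance
  exact (cancel_epi a).1 (hom_ext₃ h)

theorem hom_ext₄ {M N K L : AddCommGrpCat.{u}} {P : AddCommGrpCat.{u}}
    {f g : ((M ⊗ N) ⊗ K) ⊗ L ⟶ P}
    (h : ∀ (m : M) (n : N) (k : K) (l : L),
      f.hom (((m ⊗ₜ[ℤ] n) ⊗ₜ[ℤ] k) ⊗ₜ[ℤ] l) = g.hom (((m ⊗ₜ[ℤ] n) ⊗ₜ[ℤ] k) ⊗ₜ[ℤ] l)) : f = g := by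
  ext x
  exact DFunLike.congr_fun (TensorProduct.ext_fourfold (g := f.hom.toIntLinearMap)
    (h := g.hom.toIntLinearMap) h) x

instance : MonoidalCategory AddCommGrpCat.{u} := MonoidalCategory.ofTensorHom
  (id_tensorHom_id := fun _ _ => hom_ext fun _ _ => rfl)
  (id_tensorHom := fun _ _ _ _ => hom_ext fun _ _ => rfl)
  (tensorHom_id := fun _ _ => hom_ext fun _ _ => rfl)
  (tensorHom_comp_tensorHom := fun _ _ _ _ => hom_ext fun _ _ => rfl)
  (associator_naturality := fun _ _ _ => hom_ext₃ fun _ _ _ => rfl)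
  (leftUnitor_naturality := fun f => hom_ext fun n m => (map_zsmul f.hom n.down m).symm)
  (rightUnitor_naturality := fun f => hom_ext fun m n => (map_zsmul f.hom n.down m).symm)
  (pentagon := fun _ _ _ _ => hom_ext₄ fun _ _ _ _ => rfl)
  (triangle := fun _ _ => hom_ext₃ fun m n k => (TensorProduct.smul_tmul n.down m k).symm)

theorem associator_hom_tmul {M N K : AddCommGrpCat.{u}} (m : M) (n : N) (k : K) :
    (α_ M N K).hom.hom ((m ⊗ₜ[ℤ] n) ⊗ₜ[ℤ] k) = m ⊗ₜ[ℤ] (n ⊗ₜ[ℤ] k) := rfl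

theorem associator_inv_tmul {M N K : AddCommGrpCat.{u}} (m : M) (n : N) (k : K) :
    (α_ M N K).inv.hom (m ⊗ₜ[ℤ] (n ⊗ₜ[ℤ] k)) = (m ⊗ₜ[ℤ] n) ⊗ₜ[ℤ] k := rfl

theorem whiskerLeft_tmul (M : AddCommGrpCat.{u}) {N N' : AddCommGrpCat.{u}} (f : N ⟶ N')
    (m : M) (n : N) : (M ◁ f).hom (m ⊗ₜ[ℤ] n) = m ⊗ₜ[ℤ] f.hom n := rfl

theorem whiskerRight_tmul {M M' : AddCommGrpCat.{u}} (f : M ⟶ M') (N : AddCommGrpCat.{u})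
    (m : M) (n : N) : (f ▷ N).hom (m ⊗ₜ[ℤ] n) = f.hom m ⊗ₜ[ℤ] n := rfl

instance : SymmetricCategory AddCommGrpCat.{u} where
  braiding M N := (TensorProduct.comm ℤ M N).toAddEquiv.toAddCommGrpIso
  braiding_naturality_right _ _ _ _ := hom_ext fun _ _ => rfl
  braiding_naturality_left _ _ := hom_ext fun _ _ => rfl
  hexagon_forward _ _ _ := by
    refine hom_ext₃ fun m n k => ?_
    simp only [AddCommGrpCat.hom_comp, AddMonoidHom.comp_apply, associator_hom_tmul,
      whiskerRight_tmul]
    rfl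
  hexagon_reverse _ _ _ := by
    refine hom_ext₃' fun m n k => ?_
    simp only [AddCommGrpCat.hom_comp, AddMonoidHom.comp_apply, associator_inv_tmul,
      whiskerLeft_tmul]
    rfl
  symmetry _ _ := hom_ext fun _ _ => rfl

/-- A biadditive map as a map out of the tensor product. -/
def lift {M N P : AddCommGrpCat.{u}} (f : M →+ N →+ P) : M ⊗ N ⟶ P :=
  AddCommGrpCat.ofHom (TensorProduct.liftAddHom f (by simp))

/-- The internal hom of abelian groups is the group of homomorphisms. -/
instance : MonoidalClosed AddCommGrpCat.{u} where
  closed M :=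
    { rightAdj :=
        { obj P := .of (M →+ P)
          map f := AddCommGrpCat.ofHom (AddMonoidHom.compHom f.hom) }
      adj := Adjunction.mkOfHomEquiv
        { homEquiv N P :=
            { toFun f := AddCommGrpCat.ofHom (AddMonoidHom.mk' (fun n => AddMonoidHom.mk'
                (fun m => f.hom (m ⊗ₜ[ℤ] n))
                (fun m m' => by rw [TensorProduct.add_tmul, map_add]))
                (fun n n' => by ext m; exact (congrArg f.hom (TensorProduct.tmul_add m n n')).trans (map_add f.hom _ _)))
              invFun g := lift (AddMonoidHom.flip g.hom)
              left_inv f := hom_ext fun _ _ => rfl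
              right_inv g := rfl }
          homEquiv_naturality_left_symm := fun f g => hom_ext fun _ _ => rfl
          homEquiv_naturality_right := fun _ _ => rfl } }

end AbTensor

/-! ### Preadditive categories are enriched over abelian groups -/

/-- A preadditive category is enriched over abelian groups, with `Hom(X, Y)` the abelian group
of morphisms `X ⟶ Y`. -/
@[reducible]
def preadditiveEnriched (C : Type w) [Category.{u} C] [Preadditive C] :
    EnrichedOrdinaryCategory AddCommGrpCat.{u} C where
  Hom X Y := .of (X ⟶ Y)
  id X := AddCommGrpCat.ofHom ((zmultiplesHom (X ⟶ X) (𝟙 X)).comp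
    AddEquiv.ulift.toAddMonoidHom)
  comp X Y Z := AbTensor.lift Preadditive.compHom
  id_comp X Y := by
    ext f
    change (((1 : ℤ) • 𝟙 X) ≫ f : X ⟶ Y) = f
    simp
  comp_id X Y := by
    ext f
    change (f ≫ ((1 : ℤ) • 𝟙 Y) : X ⟶ Y) = f
    simp
  assoc X Y Z W := AbTensor.hom_ext₃' fun f g h => Category.assoc (obj := C) f g h
  homEquiv {X Y} :=
    { toFun f := AddCommGrpCat.ofHom ((zmultiplesHom (X ⟶ Y) f).comp
        AddEquiv.ulift.toAddMonoidHom)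
      invFun g := g.hom (ULift.up 1)
      left_inv f := one_zsmul f
      right_inv g := by
        ext n
        change n.down • g.hom (ULift.up 1) = g.hom n
        rw [← map_zsmul]
        exact congrArg g.hom (ULift.ext _ n (mul_one n.down)) }
  homEquiv_id X := rfl
  homEquiv_comp {X Y Z} f g := by
    ext n
    change n.down • (f ≫ g) = ((1 : ℤ) • f) ≫ (n.down • g)
    simp

/-- Left `R`-modules are enriched over abelian groups, with `Hom(M, N)` the group of `R`-linear
maps. -/
instance modEnriched (R : Type u) [Ring R] :
    EnrichedOrdinaryCategory AddCommGrpCat.{u} (ModuleCat.{u} R) :=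
  preadditiveEnriched (ModuleCat.{u} R)

/-! ### Simplicial modules -/

/-- The tensor product `M ⊗_ℤ K` of a left `R`-module and an abelian group, with `R` acting
by `r (m ⊗ a) = (r m) ⊗ a`, as a bifunctor. -/
def modTensorAb (R : Type u) [Ring R] :
    ModuleCat.{u} R ⥤ AddCommGrpCat.{u} ⥤ ModuleCat.{u} R where
  obj M :=
    { obj K := ModuleCat.of R (TensorProduct ℤ M K)
      map k := ModuleCat.ofHom
        (TensorProduct.AlgebraTensorModule.map LinearMap.id k.hom.toIntLinearMap)
      map_id K := by
        ext : 1
        exact TensorProduct.AlgebraTensorModule.ext fun _ _ => rfl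
      map_comp k l := by
        ext : 1
        exact TensorProduct.AlgebraTensorModule.ext fun _ _ => rfl }
  map f :=
    { app K := ModuleCat.ofHom
        (TensorProduct.AlgebraTensorModule.map f.hom LinearMap.id)
      naturality K L k := by
        ext : 1
        exact TensorProduct.AlgebraTensorModule.ext fun _ _ => rfl }
  map_id M := by
    ext K : 3
    exact TensorProduct.AlgebraTensorModule.ext fun _ _ => rfl
  map_comp f g := by
    ext K : 3
    exact TensorProduct.AlgebraTensorModule.ext fun _ _ => rfl

/-- A bifunctor applied degreewise to simplicial objects. -/
def degreewise {A : Type u₁} [Category.{v₁} A] {B : Type u₂} [Category.{v₂} B]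
    {C : Type u₃} [Category.{v₃} C] (F : A ⥤ B ⥤ C) :
    SimplicialObject A ⥤ SimplicialObject B ⥤ SimplicialObject C where
  obj X :=
    { obj K :=
        { obj n := (F.obj (X.obj n)).obj (K.obj n)
          map φ := (F.map (X.map φ)).app _ ≫ (F.obj _).map (K.map φ)
          map_id _ := by simp
          map_comp _ _ := by simp }
      map k :=
        { app n := (F.obj (X.obj n)).map (k.app n)
          naturality _ _ φ := by simp [← Functor.map_comp] }
      map_id _ := by ext; simp
      map_comp _ _ := by ext; simp }
  map f :=
    { app K :=
        { app n := (F.map (f.app n)).app (K.obj n)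
          naturality _ _ φ := by
            dsimp
            rw [assoc, NatTrans.naturality, ← NatTrans.comp_app_assoc, ← F.map_comp, f.naturality,
              F.map_comp, NatTrans.comp_app_assoc] }
      naturality _ _ _ := by ext; simp }
  map_id _ := by ext; simp
  map_comp _ _ := by ext; simp

/-- The degreewise tensor product of a simplicial `R`-module and a simplicial abelian group. -/
def sModTensor (R : Type u) [Ring R] :
    SimplicialObject (ModuleCat.{u} R) ⥤ SimplicialObject AddCommGrpCat.{u} ⥤
      SimplicialObject (ModuleCat.{u} R) :=
  degreewise (modTensorAb R)

instance (R : Type u) [CommRing R] : MonoidalClosed (SimplicialObject (ModuleCat.{u} R)) :=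
  MonoidalClosed.FunctorCategory.monoidalClosed

instance : MonoidalClosed (SimplicialObject AddCommGrpCat.{u}) :=
  MonoidalClosed.FunctorCategory.monoidalClosed

/-- The enrichment of simplicial `R`-modules over simplicial abelian groups. In degree `n` the
abelian group `Hom(A, B)_n` is the end of `Hom_R(A_k, B_k)` over all `φ : [k] ⟶ [n]`, that is, the
group of families of `R`-linear maps `f_φ : A_k ⟶ B_k` compatible with the simplicial structure.
Such a family is the same as a simplicial map `A ⊗ ℤΔ^n ⟶ B`, by `a ⊗ φ ↦ f_φ a`. -/
instance sModEnriched (R : Type u) [Ring R] :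
    EnrichedOrdinaryCategory (SimplicialObject AddCommGrpCat.{u})
      (SimplicialObject (ModuleCat.{u} R)) :=
  Enriched.FunctorCategory.functorEnrichedOrdinaryCategory AddCommGrpCat.{u} (ModuleCat.{u} R)
    SimplexCategoryᵒᵖ

end

noncomputable section

/-! ### Chain homotopies -/

section ChainHomotopy

variable {A : Type u} [Category.{v} A] [Preadditive A] {K L X Y : ChainComplex A ℕ}

open Homotopy HomologicalComplex

/-! On chain complexes, the model structure rests on strictifying homotopies. A homotopy equivalence
that is degreewise split, in positive degrees for a fibration, is part of a strong deformation
retraction (`exists_section_of_homotopyEquivalences`, `exists_retraction_of_homotopyEquivalences`).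
Composing a homotopy with degreewise splittings, which need not be chain maps, and applying `h ↦ dh
+ hd` still yields a chain map. Adding such a map to the obvious candidate for a lift repairs the
triangle that fails. Homotopies raise degree, so splittings of a fibration are needed only in
positive degrees. Factorizations come from adding sums of disks. These are contractible; each
complex embeds in one by a degreewise split map, and receives a map from another that is split epi
in positive degrees. The structure on simplicial objects is transported along Dold-Kan.

The tensor product is treated without comparing `N(A ⊗ B)` to `N A ⊗ N B`. First, cofibrations of
simplicial objects are exactly the degreewise split monomorphisms (`simplicialHurewicz_cof_iff`).
Secondly, each `X` has a degreewise split embedding into a cofree object, which carries a simplicial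
contraction. If `N f` is null-homotopic, it extends along the normalized embedding, so `f` itself
factors through the cofree object (`nonempty_homotopy_zero_map`). A simplicial contraction consists
of natural endomorphisms in each degree, so degreewise additive functors preserve it. Applying this
to `f g - 1` and `g f - 1` shows that tensoring with a fixed object preserves all weak equivalences
(`simplicialHurewicz_W_map`); the unit axiom follows. A pushout-product is a degreewise split mono
by inclusion-exclusion, and its acyclicity follows from stability of trivial cofibrations under
pushout and two-out-of-three (`pushoutProductAxiom_degreewise`).

For the enrichment, elements of the end defining `Hom(A, B)` are described by components. Evaluation
at identities identifies maps `L ⟶ Hom(A, B)` with maps `A ⊗ L ⟶ B`, and Yoneda then gives the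
tensor and cotensor comparisons. -/

theorem Homotopy.sub_eq_nullHomotopicMap' {f g : K ⟶ L} (h : Homotopy f g) :
    f - g = nullHomotopicMap' fun i j _ => h.hom i j := by
  have : nullHomotopicMap' (fun i j _ => h.hom i j) = nullHomotopicMap h.hom := by
    unfold nullHomotopicMap'
    congr
    ext i j
    split_ifs with hij
    · rfl
    · exact (h.zero i j hij).symm
  rw [this]
  ext n
  simp [nullHomotopicMap, h.comm n]

theorem homotopyEquivalences_of_nullHomotopicMap' (f : K ⟶ L) (g : L ⟶ K)
    (h : ∀ i j, (ComplexShape.down ℕ).Rel j i → (K.X i ⟶ K.X j))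
    (k : ∀ i j, (ComplexShape.down ℕ).Rel j i → (L.X i ⟶ L.X j))
    (hh : 𝟙 K - f ≫ g = nullHomotopicMap' h) (hk : 𝟙 L - g ≫ f = nullHomotopicMap' k) :
    homotopyEquivalences A (ComplexShape.down ℕ) f :=
  ⟨{ hom := f
     inv := g
     homotopyHomInvId := (Homotopy.equivSubZero.symm
        ((Homotopy.ofEq hh).trans (nullHomotopy' h))).symm
     homotopyInvHomId := (Homotopy.equivSubZero.symm
        ((Homotopy.ofEq hk).trans (nullHomotopy' k))).symm }, rfl⟩

theorem nullHomotopicMap'_add (h k : ∀ i j, (ComplexShape.down ℕ).Rel j i → (K.X i ⟶ L.X j)) :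
    nullHomotopicMap' (fun i j r => h i j r + k i j r) =
      nullHomotopicMap' h + nullHomotopicMap' k := by
  ext n
  rcases n with _ | n
  · simp [nullHomotopicMap'_f_of_not_rel_left (k₁ := 1) (k₀ := 0) (c := ComplexShape.down ℕ) rfl
      (by simp)]
  · simp only [nullHomotopicMap'_f (k₂ := n + 2) (k₁ := n + 1) (k₀ := n)
      (c := ComplexShape.down ℕ) rfl rfl, add_f_apply, Preadditive.comp_add, Preadditive.add_comp]
    abel

theorem nullHomotopicMap'_zero :
    nullHomotopicMap' (fun i j (_ : (ComplexShape.down ℕ).Rel j i) => (0 : K.X i ⟶ L.X j)) = 0 := by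
  simpa using nullHomotopicMap'_add (fun i j _ => (0 : K.X i ⟶ L.X j)) (fun i j _ => 0)

/-- A homotopy equivalence with sections in positive degrees is a strong deformation retraction. -/
theorem exists_section_of_homotopyEquivalences (p : X ⟶ Y)
    (hp : ∀ n : ℕ, 0 < n → IsSplitEpi (p.f n))
    (hw : homotopyEquivalences A (ComplexShape.down ℕ) p) :
    ∃ (s : Y ⟶ X) (h : ∀ i j, (ComplexShape.down ℕ).Rel j i → (X.X i ⟶ X.X j)),
      s ≫ p = 𝟙 Y ∧ 𝟙 X - p ≫ s = nullHomotopicMap' h ∧ ∀ i j r, h i j r ≫ p.f j = 0 := by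
  obtain ⟨e, rfl⟩ := hw
  have hσ : ∀ i j, (ComplexShape.down ℕ).Rel j i → ∃ σ : Y.X j ⟶ X.X j, σ ≫ e.hom.f j = 𝟙 _ := by
    intro i j r
    -- A homotopy lands in degree `j = i + 1`, so degree `0` never needs a section.
    have := hp j (by simp at r; omega)
    exact ⟨section_ _, IsSplitEpi.id _⟩
  choose σ hσ using hσ
  let k := e.homotopyInvHomId.symm
  have hk := k.sub_eq_nullHomotopicMap'
  -- The inverse `e.inv` is a section only up to `dk + kd`. Lifting `k` through the sections gives a
  -- null-homotopic chain map `n₁` whose composite with `e.hom` is exactly that defect.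
  let n₁ : Y ⟶ X := nullHomotopicMap' fun i j r => k.hom i j ≫ σ i j r
  let s : Y ⟶ X := e.inv + n₁
  have hs : s ≫ e.hom = 𝟙 Y := by
    simp only [s, n₁, Preadditive.add_comp, nullHomotopicMap'_comp, assoc, hσ, comp_id, ← hk]
    abel
  let H : Homotopy (𝟙 X) (e.hom ≫ s) :=
    (e.homotopyHomInvId.symm.trans ((Homotopy.ofEq (by simp)).trans
      (((nullHomotopy' _ : Homotopy n₁ 0).symm.compLeft e.hom).add
        (Homotopy.refl (e.hom ≫ e.inv))))).trans (Homotopy.ofEq (by simp [s, n₁, add_comm]))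
  -- With `π = 1 - ps` idempotent and `πp = 0`, composing `H` with `π` leaves its boundary `π`
  -- unchanged and makes the homotopy vertical over `Y`.
  refine ⟨s, fun i j _ => H.hom i j ≫ (𝟙 X - e.hom ≫ s).f j, hs, ?_, ?_⟩
  · rw [← nullHomotopicMap'_comp, ← H.sub_eq_nullHomotopicMap']
    simp [Preadditive.comp_sub, Preadditive.sub_comp, reassoc_of% hs]
  · intro i j _
    rw [assoc, ← comp_f]
    simp [Preadditive.sub_comp, hs]

/-- A degreewise split homotopy equivalence is the inclusion of a strong deformation retract. -/
theorem exists_retraction_of_homotopyEquivalences (i : X ⟶ Y)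
    (hi : ∀ n : ℕ, IsSplitMono (i.f n))
    (hw : homotopyEquivalences A (ComplexShape.down ℕ) i) :
    ∃ (r : Y ⟶ X) (h : ∀ m n, (ComplexShape.down ℕ).Rel n m → (Y.X m ⟶ Y.X n)),
      i ≫ r = 𝟙 X ∧ 𝟙 Y - r ≫ i = nullHomotopicMap' h ∧ ∀ m n r, i.f m ≫ h m n r = 0 := by
  obtain ⟨e, rfl⟩ := hw
  have hσ : ∀ n, ∃ σ : Y.X n ⟶ X.X n, e.hom.f n ≫ σ = 𝟙 _ := fun n =>
    ⟨retraction _, IsSplitMono.id _⟩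
  choose σ hσ using hσ
  let k := e.homotopyHomInvId.symm
  have hk := k.sub_eq_nullHomotopicMap'
  let n₁ : Y ⟶ X := nullHomotopicMap' fun i j _ => σ i ≫ k.hom i j
  let s : Y ⟶ X := e.inv + n₁
  have hs : e.hom ≫ s = 𝟙 X := by
    simp only [s, n₁, Preadditive.comp_add, comp_nullHomotopicMap', reassoc_of% hσ, ← hk]
    abel
  let H : Homotopy (𝟙 Y) (s ≫ e.hom) :=
    (e.homotopyInvHomId.symm.trans ((Homotopy.ofEq (by simp)).trans
      (((nullHomotopy' _ : Homotopy n₁ 0).symm.compRight e.hom).add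
        (Homotopy.refl (e.inv ≫ e.hom))))).trans (Homotopy.ofEq (by simp [s, n₁, add_comm]))
  -- Dually, precomposing with the idempotent `1 - s ≫ e.hom` keeps the boundary and makes the
  -- homotopy vanish on the image of `e.hom`.
  refine ⟨s, fun i j _ => (𝟙 Y - s ≫ e.hom).f i ≫ H.hom i j, hs, ?_, ?_⟩
  · rw [← comp_nullHomotopicMap', ← H.sub_eq_nullHomotopicMap']
    simp [Preadditive.comp_sub, Preadditive.sub_comp, reassoc_of% hs]
  · intro i j _
    rw [← assoc, ← comp_f]
    simp [Preadditive.comp_sub, reassoc_of% hs]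

/-- The map `v ≫ s` lifts `v` but restricts to `u ≫ p ≫ s` instead of `u`. The error `u ≫ (1 - ps)`
is null-homotopic through a vertical homotopy, so it extends to `B` by degreewise retractions of `i`
without disturbing the composite with `p`. -/
theorem hasLiftingProperty_of_trivial_fibration {B : ChainComplex A ℕ} (i : K ⟶ B) (p : X ⟶ Y)
    (hi : ∀ n : ℕ, IsSplitMono (i.f n)) (hp : ∀ n : ℕ, 0 < n → IsSplitEpi (p.f n))
    (hw : homotopyEquivalences A (ComplexShape.down ℕ) p) : HasLiftingProperty i p where
  sq_hasLift {u v} sq := by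
    obtain ⟨s, h, hs, hh, h0⟩ := exists_section_of_homotopyEquivalences p hp hw
    have hr : ∀ n, ∃ r : B.X n ⟶ K.X n, i.f n ≫ r = 𝟙 _ := fun n => ⟨retraction _, IsSplitMono.id _⟩
    choose r hr using hr
    refine ⟨⟨⟨v ≫ s + nullHomotopicMap' fun m n t => r m ≫ u.f m ≫ h m n t, ?_, ?_⟩⟩⟩
    · rw [Preadditive.comp_add, comp_nullHomotopicMap']
      simp only [reassoc_of% hr]
      rw [← comp_nullHomotopicMap', ← hh, ← reassoc_of% sq.w]
      simp [Preadditive.comp_sub]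
    · rw [Preadditive.add_comp, nullHomotopicMap'_comp]
      simp [h0, nullHomotopicMap'_zero, hs]

/-- The map `r ≫ u` extends `u` but lies over `r ≫ i ≫ v`. The error `(1 - ri) ≫ v` is
null-homotopic by a homotopy vanishing on `K`, which is lifted through `p` in the positive degrees
where it lands. -/
theorem hasLiftingProperty_of_trivial_cofibration {B : ChainComplex A ℕ} (i : K ⟶ B) (p : X ⟶ Y)
    (hi : ∀ n : ℕ, IsSplitMono (i.f n)) (hp : ∀ n : ℕ, 0 < n → IsSplitEpi (p.f n))
    (hw : homotopyEquivalences A (ComplexShape.down ℕ) i) : HasLiftingProperty i p where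
  sq_hasLift {u v} sq := by
    obtain ⟨r, h, hr, hh, h0⟩ := exists_retraction_of_homotopyEquivalences i hi hw
    have hσ : ∀ i j, (ComplexShape.down ℕ).Rel j i → ∃ σ : Y.X j ⟶ X.X j, σ ≫ p.f j = 𝟙 _ := by
      intro i j r
      have := hp j (by simp at r; omega)
      exact ⟨section_ _, IsSplitEpi.id _⟩
    choose σ hσ using hσ
    refine ⟨⟨⟨r ≫ u + nullHomotopicMap' fun m n t => h m n t ≫ v.f n ≫ σ m n t, ?_, ?_⟩⟩⟩
    · rw [Preadditive.comp_add, comp_nullHomotopicMap']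
      simp [reassoc_of% h0, nullHomotopicMap'_zero, reassoc_of% hr]
    · rw [Preadditive.add_comp, nullHomotopicMap'_comp]
      simp only [assoc, hσ, comp_id]
      rw [← nullHomotopicMap'_comp, ← hh, sq.w]
      simp [Preadditive.sub_comp]

/-- A null-homotopic map extends along any degreewise split monomorphism. -/
theorem exists_extension_of_homotopy_zero {B : ChainComplex A ℕ} (j : K ⟶ B)
    (hj : ∀ n : ℕ, IsSplitMono (j.f n)) (f : K ⟶ L) (h : Homotopy f 0) :
    ∃ g : B ⟶ L, j ≫ g = f := by
  have hr : ∀ n, ∃ r : B.X n ⟶ K.X n, j.f n ≫ r = 𝟙 _ := fun n => ⟨retraction _, IsSplitMono.id _⟩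
  choose r hr using hr
  refine ⟨nullHomotopicMap' fun m n _ => r m ≫ h.hom m n, ?_⟩
  simp only [comp_nullHomotopicMap', reassoc_of% hr, ← h.sub_eq_nullHomotopicMap', sub_zero]

end ChainHomotopy

/-! ### Sums of disks -/

section DiskSum

variable {A : Type u} [Category.{v} A] [Abelian A]

open scoped ZeroObject

/-- The sequence `G` shifted by one, with a zero object in degree `0`. -/
def shiftSeq (G : ℕ → A) : ℕ → A
  | 0 => (0 : A)
  | n + 1 => G n

/-- The terms of the shifted sequence in positive degrees. -/
def shiftSeqIso (G : ℕ → A) (n : ℕ) : shiftSeq G (n + 1) ≅ G n := Iso.refl _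

theorem isZero_shiftSeq (G : ℕ → A) : IsZero (shiftSeq G 0) := isZero_zero A

/-- The direct sum over `n` of the disks on `G n` in degrees `n + 1` and `n`. -/
def diskSum (G : ℕ → A) : ChainComplex A ℕ :=
  ChainComplex.of (fun n => shiftSeq G n ⊞ G n)
    (fun n => biprod.fst ≫ (shiftSeqIso G n).hom ≫ biprod.inr) (fun n => by simp)

namespace diskSum

variable (G : ℕ → A)

/-- The inclusion of the tops of the disks. -/
def inl (n : ℕ) : shiftSeq G n ⟶ (diskSum G).X n := biprod.inl

/-- The inclusion of the bottoms of the disks. -/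
def inr (n : ℕ) : G n ⟶ (diskSum G).X n := biprod.inr

/-- The projection to the tops of the disks. -/
def fst (n : ℕ) : (diskSum G).X n ⟶ shiftSeq G n := biprod.fst

/-- The projection to the bottoms of the disks. -/
def snd (n : ℕ) : (diskSum G).X n ⟶ G n := biprod.snd

@[simp]
theorem inl_fst (n : ℕ) : inl G n ≫ fst G n = 𝟙 _ := biprod.inl_fst

@[simp]
theorem inl_fst_assoc (n : ℕ) {Z : A} (f : shiftSeq G n ⟶ Z) : inl G n ≫ fst G n ≫ f = f := by
  rw [← assoc, inl_fst, id_comp]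

@[simp]
theorem inl_snd (n : ℕ) : inl G n ≫ snd G n = 0 := biprod.inl_snd

@[simp]
theorem inl_snd_assoc (n : ℕ) {Z : A} (f : G n ⟶ Z) : inl G n ≫ snd G n ≫ f = 0 := by
  rw [← assoc, inl_snd, zero_comp]

@[simp]
theorem inr_fst (n : ℕ) : inr G n ≫ fst G n = 0 := biprod.inr_fst

@[simp]
theorem inr_fst_assoc (n : ℕ) {Z : A} (f : shiftSeq G n ⟶ Z) : inr G n ≫ fst G n ≫ f = 0 := by
  rw [← assoc, inr_fst, zero_comp]

@[simp]
theorem inr_snd (n : ℕ) : inr G n ≫ snd G n = 𝟙 _ := biprod.inr_snd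

@[simp]
theorem inr_snd_assoc (n : ℕ) {Z : A} (f : G n ⟶ Z) : inr G n ≫ snd G n ≫ f = f := by
  rw [← assoc, inr_snd, id_comp]

theorem total (n : ℕ) : fst G n ≫ inl G n + snd G n ≫ inr G n = 𝟙 _ := biprod.total

theorem d_eq (n : ℕ) :
    (diskSum G).d (n + 1) n = fst G (n + 1) ≫ (shiftSeqIso G n).hom ≫ inr G n :=
  ChainComplex.of_d (fun n => shiftSeq G n ⊞ G n)
    (fun n => biprod.fst ≫ (shiftSeqIso G n).hom ≫ biprod.inr) n

/-- The contraction of a sum of disks. -/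
def contraction (i j : ℕ) (h : (ComplexShape.down ℕ).Rel j i) :
    (diskSum G).X i ⟶ (diskSum G).X j :=
  snd G i ≫ (shiftSeqIso G i).inv ≫ inl G (i + 1) ≫
    eqToHom (by obtain rfl : i + 1 = j := h; rfl)

theorem nullHomotopicMap'_contraction : Homotopy.nullHomotopicMap' (contraction G) = 𝟙 _ := by
  ext n
  rcases n with _ | n
  · rw [Homotopy.nullHomotopicMap'_f_of_not_rel_left (k₁ := 1) (k₀ := 0)
      (c := ComplexShape.down ℕ) rfl (by simp)]
    -- In degree `0` there is no top of a disk, so the bottom alone is the whole object.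
    have : fst G 0 = 0 := (isZero_shiftSeq G).eq_of_tgt _ _
    have h := total G 0
    rw [this] at h
    simpa [contraction, d_eq] using h
  · rw [Homotopy.nullHomotopicMap'_f (k₂ := n + 2) (k₁ := n + 1) (k₀ := n)
      (c := ComplexShape.down ℕ) rfl rfl]
    simpa [contraction, d_eq] using total G (n + 1)

variable {G} {K : ChainComplex A ℕ}

/-- The components of `diskSum.lift` at the tops of the disks. -/
def liftTop (φ : ∀ n, K.X n ⟶ G n) : ∀ n, K.X n ⟶ shiftSeq G n
  | 0 => 0
  | n + 1 => K.d (n + 1) n ≫ φ n ≫ (shiftSeqIso G n).inv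

/-- The components of `diskSum.desc` at the tops of the disks. -/
def descTop (φ : ∀ n, G n ⟶ K.X (n + 1)) : ∀ n, shiftSeq G n ⟶ K.X n
  | 0 => 0
  | n + 1 => (shiftSeqIso G n).hom ≫ φ n

theorem d_comp_liftTop (φ : ∀ n, K.X n ⟶ G n) (n : ℕ) : K.d (n + 1) n ≫ liftTop φ n = 0 := by
  rcases n with _ | n <;> simp [liftTop]

theorem descTop_comp_d (φ : ∀ n, G n ⟶ K.X (n + 1)) (n : ℕ) :
    descTop φ (n + 1) ≫ K.d (n + 1) n = (shiftSeqIso G n).hom ≫ φ n ≫ K.d (n + 1) n := by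
  simp [descTop]

/-- Families of maps into the bottoms of the disks are maps into a sum of disks. -/
def lift (φ : ∀ n, K.X n ⟶ G n) : K ⟶ diskSum G where
  f n := liftTop φ n ≫ inl G n + φ n ≫ inr G n
  comm' i j h := by
    obtain rfl : j + 1 = i := h
    rw [d_eq, Preadditive.comp_add, reassoc_of% d_comp_liftTop φ j]
    simp [liftTop]

/-- Families of maps out of the tops of the disks are maps out of a sum of disks. -/
def desc (φ : ∀ n, G n ⟶ K.X (n + 1)) : diskSum G ⟶ K where
  f n := fst G n ≫ descTop φ n + snd G n ≫ φ n ≫ K.d (n + 1) n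
  comm' i j h := by
    obtain rfl : j + 1 = i := h
    rw [d_eq, Preadditive.add_comp, assoc, descTop_comp_d]
    simp

end diskSum

end DiskSum

/-! ### The Hurewicz model structure on chain complexes -/

section ChainModel

variable {A : Type u} [Category.{v} A] [Abelian A]

open HomologicalComplex

/-- The defect of `biprod.inl` as an inverse is the projector onto the disks, and the contraction of
the disks exhibits it as null-homotopic. -/
theorem homotopyEquivalences_biprod_fst (K : ChainComplex A ℕ) (G : ℕ → A) :
    homotopyEquivalences A _ (biprod.fst : K ⊞ diskSum G ⟶ K) := by
  refine homotopyEquivalences_of_nullHomotopicMap' _ biprod.inl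
    (fun i j r => (biprod.snd : K ⊞ diskSum G ⟶ _).f i ≫ diskSum.contraction G i j r ≫
      (biprod.inr : diskSum G ⟶ K ⊞ _).f j) (fun _ _ _ => 0) ?_ ?_
  · rw [← Homotopy.comp_nullHomotopicMap' _
      (fun i j r => diskSum.contraction G i j r ≫ (biprod.inr : diskSum G ⟶ K ⊞ _).f j),
      ← Homotopy.nullHomotopicMap'_comp, diskSum.nullHomotopicMap'_contraction, id_comp,
      ← biprod.total]
    abel
  · simp [nullHomotopicMap'_zero]

theorem homotopyEquivalences_biprod_inl (K : ChainComplex A ℕ) (G : ℕ → A) :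
    homotopyEquivalences A _ (biprod.inl : K ⟶ K ⊞ diskSum G) :=
  MorphismProperty.of_postcomp _ _ _ (homotopyEquivalences_biprod_fst K G)
    (by rw [biprod.inl_fst]; exact homotopyEquivalences.of_isIso _)

/-- The inverse of `g` is compressed by the retract data, and so are its two homotopies. -/
instance : (homotopyEquivalences A (ComplexShape.down ℕ)).IsStableUnderRetracts where
  of_retract {X Y Z W f g} h hg := by
    obtain ⟨e, rfl⟩ := hg
    refine ⟨⟨f, h.i.right ≫ e.inv ≫ h.r.left, ?_, ?_⟩, rfl⟩
    · refine (Homotopy.ofEq ?_).trans (((e.homotopyHomInvId.compLeft h.i.left).compRight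
        h.r.left).trans (Homotopy.ofEq (by simp)))
      simp only [assoc, h.i_w_assoc]
    · refine (Homotopy.ofEq ?_).trans (((e.homotopyInvHomId.compLeft h.i.right).compRight
        h.r.right).trans (Homotopy.ofEq (by simp)))
      simp only [assoc, h.r_w]

theorem isSplitMono_of_comp {C : Type*} [Category* C] {X Y Z : C} (f : X ⟶ Y) (g : Y ⟶ Z)
    [IsSplitMono (f ≫ g)] : IsSplitMono f :=
  ⟨⟨⟨g ≫ retraction (f ≫ g), by rw [← assoc, IsSplitMono.id]⟩⟩⟩

theorem isSplitEpi_of_comp {C : Type*} [Category* C] {X Y Z : C} (f : X ⟶ Y) (g : Y ⟶ Z)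
    [IsSplitEpi (f ≫ g)] : IsSplitEpi g :=
  ⟨⟨⟨section_ (f ≫ g) ≫ f, by rw [assoc, IsSplitEpi.id]⟩⟩⟩

theorem isSplitMono_of_retractArrow {C : Type*} [Category* C] {X Y Z W : C} {f : X ⟶ Y} {g : Z ⟶ W}
    (h : RetractArrow f g) [IsSplitMono g] : IsSplitMono f :=
  ⟨⟨⟨h.i.right ≫ retraction g ≫ h.r.left, by
    rw [← h.i_w_assoc, IsSplitMono.id_assoc]; exact h.retract_left⟩⟩⟩

theorem isSplitEpi_of_retractArrow {C : Type*} [Category* C] {X Y Z W : C} {f : X ⟶ Y} {g : Z ⟶ W}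
    (h : RetractArrow f g) [IsSplitEpi g] : IsSplitEpi f :=
  ⟨⟨⟨h.i.right ≫ section_ g ≫ h.r.left, by
    simp only [assoc]; rw [h.r_w, IsSplitEpi.id_assoc]; exact h.retract_right⟩⟩⟩

/-- Evaluating a retract of arrows of chain complexes in one degree. -/
def RetractArrow.eval {K L K' L' : ChainComplex A ℕ} {f : K ⟶ L} {g : K' ⟶ L'}
    (h : RetractArrow f g) (n : ℕ) : RetractArrow (f.f n) (g.f n) :=
  RetractArrow.map h (HomologicalComplex.eval A _ n)

instance : (chainHurewicz A).cof.IsStableUnderRetracts where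
  of_retract h hg n := by
    have := hg n
    exact isSplitMono_of_retractArrow (RetractArrow.eval h n)

instance : (chainHurewicz A).fib.IsStableUnderRetracts where
  of_retract h hg n hn := by
    have := hg n hn
    exact isSplitEpi_of_retractArrow (RetractArrow.eval h n)

theorem isSplitMono_f_of_comp {K L M : ChainComplex A ℕ} (f : K ⟶ L) (g : L ⟶ M) (n : ℕ)
    (h : IsSplitMono ((f ≫ g).f n)) : IsSplitMono (f.f n) := by
  rw [comp_f] at h
  exact isSplitMono_of_comp _ (g.f n)

theorem isSplitEpi_f_of_comp {K L M : ChainComplex A ℕ} (f : K ⟶ L) (g : L ⟶ M) (n : ℕ)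
    (h : IsSplitEpi ((f ≫ g).f n)) : IsSplitEpi (g.f n) := by
  rw [comp_f] at h
  exact isSplitEpi_of_comp (f.f n) _

theorem isSplitMono_diskSum_lift (K : ChainComplex A ℕ) (n : ℕ) :
    IsSplitMono ((diskSum.lift fun n => 𝟙 (K.X n)).f n) :=
  ⟨⟨⟨diskSum.snd K.X n, by simp [diskSum.lift]⟩⟩⟩

/-- The tops of the disks give the section. In degree `0` there are none and the map reduces to the
differential from degree `1`, which need not be split epi. -/
theorem isSplitEpi_diskSum_desc (K : ChainComplex A ℕ) (n : ℕ) (hn : 0 < n) :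
    IsSplitEpi ((diskSum.desc fun n => 𝟙 (K.X (n + 1))).f n) := by
  obtain ⟨n, rfl⟩ := Nat.exists_eq_succ_of_ne_zero hn.ne'
  exact ⟨⟨⟨(shiftSeqIso (fun n => K.X (n + 1)) n).inv ≫ diskSum.inl _ (n + 1), by
    simp [diskSum.desc, diskSum.descTop]⟩⟩⟩

variable (A) in
/-- The Hurewicz model structure on non-negatively graded chain complexes. -/
@[reducible]
def chainModelCategory : HomotopicalAlgebra.ModelCategory (ChainComplex A ℕ) where
  categoryWithFibrations := ⟨(chainHurewicz A).fib⟩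
  categoryWithCofibrations := ⟨(chainHurewicz A).cof⟩
  categoryWithWeakEquivalences := ⟨(chainHurewicz A).W⟩
  cm2 := inferInstanceAs (homotopyEquivalences A (ComplexShape.down ℕ)).HasTwoOutOfThreeProperty
  cm3a := inferInstanceAs (homotopyEquivalences A (ComplexShape.down ℕ)).IsStableUnderRetracts
  cm3b := inferInstanceAs (chainHurewicz A).fib.IsStableUnderRetracts
  cm3c := inferInstanceAs (chainHurewicz A).cof.IsStableUnderRetracts
  cm4a i p hi hw hp := hasLiftingProperty_of_trivial_cofibration i p hi.1 hp.1 hw.1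
  cm4b i p hi hp hw := hasLiftingProperty_of_trivial_fibration i p hi.1 hp.1 hw.1
  cm5a := ⟨fun {X Y} f => ⟨{
    -- The disks have their tops on the terms of `Y` in positive degrees, making `p` split epi there
    -- whatever `f` is.
    Z := X ⊞ diskSum fun n => Y.X (n + 1)
    i := biprod.inl
    p := biprod.desc f (diskSum.desc fun n => 𝟙 _)
    hi := ⟨fun n => isSplitMono_f_of_comp _ biprod.fst n (by
        rw [biprod.inl_fst]
        exact inferInstanceAs (IsSplitMono (𝟙 (X.X n)))),
      homotopyEquivalences_biprod_inl _ _⟩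
    hp := fun n hn => isSplitEpi_f_of_comp biprod.inr _ n (by
      rw [biprod.inr_desc]
      exact isSplitEpi_diskSum_desc Y n hn) }⟩⟩
  cm5b := ⟨fun {X Y} f => ⟨{
    -- Here the bottoms of the disks are the terms of `X`; projecting to them retracts `i` in every
    -- degree.
    Z := Y ⊞ diskSum X.X
    i := biprod.lift f (diskSum.lift fun n => 𝟙 _)
    p := biprod.fst
    hi := fun n => isSplitMono_f_of_comp _ biprod.snd n (by
      rw [biprod.lift_snd]
      exact isSplitMono_diskSum_lift X n)
    hp := ⟨fun n _ => isSplitEpi_f_of_comp biprod.inl _ n (by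
        rw [biprod.inl_fst]
        exact inferInstanceAs (IsSplitEpi (𝟙 (Y.X n)))),
      homotopyEquivalences_biprod_fst _ _⟩ }⟩⟩

theorem chainHurewicz_isModelCategory [HasLimits A] [HasColimits A] :
    (chainHurewicz A).IsModelCategory where
  hasLimits := ⟨fun _ _ => inferInstance⟩
  hasColimits := ⟨fun _ _ => inferInstance⟩
  exists_modelCategory := ⟨chainModelCategory A, rfl, rfl, rfl⟩

variable (A) in
/-- The Hurewicz model structure on simplicial objects. -/
@[reducible]
def simplicialModelCategory : HomotopicalAlgebra.ModelCategory (SimplicialObject A) :=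
  letI := chainModelCategory A
  letI : HomotopicalAlgebra.CategoryWithFibrations (SimplicialObject A) :=
    ⟨(simplicialHurewicz A).fib⟩
  letI : HomotopicalAlgebra.CategoryWithCofibrations (SimplicialObject A) :=
    ⟨(simplicialHurewicz A).cof⟩
  letI : HomotopicalAlgebra.CategoryWithWeakEquivalences (SimplicialObject A) :=
    ⟨(simplicialHurewicz A).W⟩
  .transport Abelian.DoldKan.equivalence rfl rfl rfl

theorem simplicialHurewicz_isModelCategory [HasLimits A] [HasColimits A] :
    (simplicialHurewicz A).IsModelCategory where
  hasLimits := inferInstanceAs (HasLimits (SimplexCategoryᵒᵖ ⥤ A))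
  hasColimits := inferInstanceAs (HasColimits (SimplexCategoryᵒᵖ ⥤ A))
  exists_modelCategory := ⟨simplicialModelCategory A, rfl, rfl, rfl⟩

end ChainModel

/-! ### Contractions of simplicial objects -/

section Contraction

open Simplicial AlgebraicTopology

/-- The monotone map `[n + 1] ⟶ [1]` sending exactly the elements `≤ i` to `0`. -/
def SimplexCategory.cut {n : ℕ} (i : Fin (n + 1)) : ⦋n + 1⦌ ⟶ ⦋1⦌ :=
  SimplexCategory.mkHom ⟨fun x => if x ≤ i.castSucc then 0 else 1, fun x y h => by
    dsimp only
    split_ifs with h₁ h₂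
    · exact le_rfl
    · exact Fin.zero_le _
    · exact absurd (h.trans ‹_›) h₁
    · exact le_rfl⟩

theorem SimplexCategory.cut_apply {n : ℕ} (i : Fin (n + 1)) (x : Fin (n + 2)) :
    (SimplexCategory.cut i).toOrderHom x = if x ≤ i.castSucc then 0 else 1 := rfl

-- This and the next six rules supply, one each, the seven axioms of a combinatorial simplicial
-- homotopy checked in `toHomotopy`.
open SimplexCategory in
theorem SimplexCategory.δ_zero_cut (n : ℕ) :
    δ 0 ≫ cut (0 : Fin (n + 1)) = SimplexCategory.const ⦋n⦌ ⦋1⦌ 1 := by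
  ext x : 3
  change (cut (0 : Fin (n + 1))).toOrderHom (Fin.succAbove 0 x) = 1
  rw [cut_apply, if_neg]
  simp

open SimplexCategory in
theorem SimplexCategory.δ_last_cut (n : ℕ) :
    δ (Fin.last (n + 1)) ≫ cut (Fin.last n) = SimplexCategory.const ⦋n⦌ ⦋1⦌ 0 := by
  ext x : 3
  change (cut (Fin.last n)).toOrderHom (Fin.succAbove (Fin.last _) x) = 0
  rw [cut_apply, if_pos]
  simp [Fin.le_last]

open SimplexCategory in
theorem SimplexCategory.δ_cut_of_le {n : ℕ} (i : Fin (n + 2)) (j : Fin (n + 1))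
    (h : i ≤ j.castSucc) : δ i.castSucc ≫ cut j.succ = cut j := by
  ext x : 3
  change (cut j.succ).toOrderHom (Fin.succAbove i.castSucc x) = (cut j).toOrderHom x
  rw [cut_apply, cut_apply]
  congr 1
  simp only [Fin.succAbove, Fin.le_def, Fin.lt_def, eq_iff_iff] at *
  split_ifs <;> simp at *
  omega

open SimplexCategory in
theorem SimplexCategory.δ_cut_of_gt {n : ℕ} (i : Fin (n + 2)) (j : Fin (n + 1))
    (h : j.castSucc < i) : δ i.succ ≫ cut j.castSucc = cut j := by
  ext x : 3
  change (cut j.castSucc).toOrderHom (Fin.succAbove i.succ x) = (cut j).toOrderHom x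
  rw [cut_apply, cut_apply]
  congr 1
  simp only [Fin.succAbove, Fin.le_def, Fin.lt_def, eq_iff_iff] at *
  split_ifs <;> simp at *
  omega

open SimplexCategory in
theorem SimplexCategory.δ_cut_castSucc_succ {n : ℕ} (j : Fin (n + 1)) :
    δ j.castSucc.succ ≫ cut j.succ = δ j.castSucc.succ ≫ cut j.castSucc := by
  ext x : 3
  change (cut j.succ).toOrderHom (Fin.succAbove j.castSucc.succ x) =
    (cut j.castSucc).toOrderHom (Fin.succAbove j.castSucc.succ x)
  rw [cut_apply, cut_apply]
  congr 1
  simp only [Fin.succAbove, Fin.le_def, Fin.lt_def, eq_iff_iff] at *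
  split_ifs <;> (simp at *; omega)

open SimplexCategory in
theorem SimplexCategory.σ_cut_of_le {n : ℕ} (i j : Fin (n + 1)) (h : i ≤ j) :
    σ i.castSucc ≫ cut j = cut j.succ := by
  ext x : 3
  change (cut j).toOrderHom (Fin.predAbove i.castSucc x) = (cut j.succ).toOrderHom x
  rw [cut_apply, cut_apply]
  congr 1
  rcases lt_or_ge (i.castSucc.castSucc) x with hx | hx
  · rw [Fin.predAbove_of_castSucc_lt _ _ hx]
    have hx' : (i : ℕ) < x := by simpa [Fin.lt_def] using hx
    simp only [Fin.le_def, Fin.val_succ, Fin.val_castSucc, Fin.val_pred,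
      eq_iff_iff] at h ⊢
    omega
  · rw [Fin.predAbove_of_le_castSucc _ _ hx]
    have hx' : (x : ℕ) ≤ (i : ℕ) := by simpa [Fin.le_def] using hx
    simp only [Fin.le_def, Fin.val_succ, Fin.val_castSucc, eq_iff_iff] at h ⊢
    change (x : ℕ) ≤ _ ↔ _
    omega

open SimplexCategory in
theorem SimplexCategory.σ_cut_of_ge {n : ℕ} (i j : Fin (n + 1)) (h : j ≤ i) :
    σ i.succ ≫ cut j = cut j.castSucc := by
  ext x : 3
  change (cut j).toOrderHom (Fin.predAbove i.succ x) = (cut j.castSucc).toOrderHom x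
  rw [cut_apply, cut_apply]
  congr 1
  rcases lt_or_ge (i.succ.castSucc) x with hx | hx
  · rw [Fin.predAbove_of_castSucc_lt _ _ hx]
    have hx' : (i : ℕ) + 1 < x := by simpa [Fin.lt_def] using hx
    simp only [Fin.le_def, Fin.val_castSucc, Fin.val_pred, eq_iff_iff] at h ⊢
    omega
  · rw [Fin.predAbove_of_le_castSucc _ _ hx]
    have hx' : (x : ℕ) ≤ (i : ℕ) + 1 := by simpa [Fin.le_def] using hx
    simp only [Fin.le_def, Fin.val_castSucc, eq_iff_iff] at h ⊢
    change (x : ℕ) ≤ _ ↔ _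
    omega

variable {A : Type u} [Category.{v} A]

/-- A simplicial homotopy from the identity to zero on `X`, given as a family of endomorphisms
of `X.obj n` indexed by the `n`-simplices of the interval. -/
structure SimplicialContraction [HasZeroMorphisms A] (X : SimplicialObject A) where
  /-- the endomorphism indexed by a simplex of the interval -/
  hom (n : SimplexCategoryᵒᵖ) (σ : n.unop ⟶ ⦋1⦌) : X.obj n ⟶ X.obj n
  naturality {m n : SimplexCategoryᵒᵖ} (θ : m ⟶ n) (σ : m.unop ⟶ ⦋1⦌) :
    hom m σ ≫ X.map θ = X.map θ ≫ hom n (θ.unop ≫ σ)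
  hom_zero (n : SimplexCategoryᵒᵖ) : hom n (SimplexCategory.const _ _ 0) = 𝟙 _
  hom_one (n : SimplexCategoryᵒᵖ) : hom n (SimplexCategory.const _ _ 1) = 0

namespace SimplicialContraction

section

variable [HasZeroMorphisms A] {X : SimplicialObject A} (c : SimplicialContraction X)

theorem hom_δ {n : ℕ} (σ : ⦋n + 1⦌ ⟶ ⦋1⦌) (i : Fin (n + 2)) :
    c.hom (op ⦋n + 1⦌) σ ≫ X.δ i = X.δ i ≫ c.hom (op ⦋n⦌) (SimplexCategory.δ i ≫ σ) :=
  c.naturality (SimplexCategory.δ i).op σ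

theorem hom_σ {n : ℕ} (σ : ⦋n⦌ ⟶ ⦋1⦌) (i : Fin (n + 1)) :
    c.hom (op ⦋n⦌) σ ≫ X.σ i = X.σ i ≫ c.hom (op ⦋n + 1⦌) (SimplexCategory.σ i ≫ σ) :=
  c.naturality (SimplexCategory.σ i).op σ

open SimplicialObject in
/-- The combinatorial simplicial homotopy associated with a contraction. -/
def toHomotopy : SimplicialObject.Homotopy (𝟙 X) 0 where
  -- The pair (`σ i`, `cut i`) is the `i`-th top simplex of the prism `Δ^n × Δ^1`, running along the
  -- bottom to vertex `i` and then along the top.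
  h {n} i := X.σ i ≫ c.hom (op ⦋n + 1⦌) (SimplexCategory.cut i)
  h_zero_comp_δ_zero n := by
    rw [assoc, hom_δ, SimplexCategory.δ_zero_cut]
    exact (congrArg _ (congrArg _ (c.hom_one _))).trans (by simp)
  h_last_comp_δ_last n := by
    have := X.δ_comp_σ_succ (i := Fin.last n)
    rw [Fin.succ_last] at this
    rw [assoc, hom_δ, SimplexCategory.δ_last_cut, reassoc_of% this]
    exact c.hom_zero _
  h_succ_comp_δ_castSucc_of_lt i j hij := by
    rw [assoc, hom_δ, SimplexCategory.δ_cut_of_le i j hij, X.δ_comp_σ_of_le_assoc hij]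
  h_succ_comp_δ_castSucc_succ j := by
    rw [assoc, assoc, hom_δ, hom_δ, SimplexCategory.δ_cut_castSucc_succ]
    have h₁ := X.δ_comp_σ_self (i := j.succ)
    have h₂ := X.δ_comp_σ_succ (i := j.castSucc)
    rw [← Fin.succ_castSucc] at h₁
    rw [reassoc_of% h₁, reassoc_of% h₂]
  h_castSucc_comp_δ_succ_of_lt i j hji := by
    rw [assoc, hom_δ, SimplexCategory.δ_cut_of_gt i j hji, X.δ_comp_σ_of_gt_assoc hji]
  h_comp_σ_castSucc_of_le i j hij := by
    rw [assoc, hom_σ, SimplexCategory.σ_cut_of_le i j hij, X.σ_comp_σ_assoc hij]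
  h_comp_σ_succ_of_lt i j hji := by
    rw [assoc, hom_σ, SimplexCategory.σ_cut_of_ge i j hji, X.σ_comp_σ_assoc hji]

end

/-- The normalized complex of a simplicially contractible object is contractible. -/
def normalizedHomotopy [Abelian A] {X : SimplicialObject A} (c : SimplicialContraction X) :
    Homotopy (𝟙 ((normalizedMooreComplex A).obj X)) 0 :=
  (Homotopy.ofEq (by
    rw [CategoryTheory.Functor.map_id]
    erw [comp_id]
    exact (DoldKan.splitMonoInclusionOfMooreComplexMap X).id.symm)).trans
  (((c.toHomotopy.toChainHomotopy.compLeft (inclusionOfMooreComplexMap X)).compRight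
    (DoldKan.PInftyToNormalizedMooreComplex X)).trans (Homotopy.ofEq (by
      rw [Functor.map_zero, comp_zero]
      exact zero_comp)))

end SimplicialContraction

/-! ### Cofree simplicial objects and their contractions. -/

variable [HasProducts.{0} A]

/-- The factors of the cofree simplicial object. -/
abbrev cofreeFactor (X : SimplicialObject A) (n : SimplexCategoryᵒᵖ)
    (p : Σ k : SimplexCategory, (k ⟶ n.unop)) : A := X.obj (op p.1)

/-- The cofree simplicial object on the sequence of objects underlying `X`. -/
def cofreeSimplicial (X : SimplicialObject A) : SimplicialObject A where
  obj n := ∏ᶜ cofreeFactor X n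
  map {m n} θ := Pi.lift fun p => Pi.π (cofreeFactor X m) ⟨p.1, p.2 ≫ θ.unop⟩
  map_id n := by
    refine Pi.hom_ext _ _ fun p => ?_
    rw [Pi.lift_π, id_comp, unop_id]
    congr 2
    exact comp_id _
  map_comp θ θ' := by
    refine Pi.hom_ext _ _ fun p => ?_
    rw [Pi.lift_π, assoc, Pi.lift_π, Pi.lift_π, unop_comp, assoc]

/-- The projection from the cofree simplicial object to a factor. -/
def cofreeSimplicial.π (X : SimplicialObject A) (n : SimplexCategoryᵒᵖ)
    (p : Σ k : SimplexCategory, (k ⟶ n.unop)) :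
    (cofreeSimplicial X).obj n ⟶ cofreeFactor X n p := Pi.π _ p

/-- A map to the cofree simplicial object in one degree. -/
def cofreeSimplicial.lift (X : SimplicialObject A) (n : SimplexCategoryᵒᵖ) {Z : A}
    (f : ∀ p, Z ⟶ cofreeFactor X n p) : Z ⟶ (cofreeSimplicial X).obj n := Pi.lift f

@[simp]
theorem cofreeSimplicial.lift_π (X : SimplicialObject A) (n : SimplexCategoryᵒᵖ) {Z : A}
    (f : ∀ p, Z ⟶ cofreeFactor X n p) (p) : lift X n f ≫ π X n p = f p := Pi.lift_π _ _

theorem cofreeSimplicial.map_π (X : SimplicialObject A) {m n : SimplexCategoryᵒᵖ} (θ : m ⟶ n)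
    (p : Σ k : SimplexCategory, (k ⟶ n.unop)) :
    (cofreeSimplicial X).map θ ≫ π X n p = π X m ⟨p.1, p.2 ≫ θ.unop⟩ :=
  Pi.lift_π _ _

theorem cofreeSimplicial.hom_ext (X : SimplicialObject A) {n : SimplexCategoryᵒᵖ} {Z : A}
    {f g : Z ⟶ (cofreeSimplicial X).obj n} (h : ∀ p, f ≫ π X n p = g ≫ π X n p) : f = g :=
  Pi.hom_ext _ _ h

/-- The embedding of `X` in the cofree simplicial object. -/
def toCofreeSimplicial (X : SimplicialObject A) : X ⟶ cofreeSimplicial X where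
  app n := cofreeSimplicial.lift X n fun p => X.map p.2.op
  naturality m n θ := by
    refine cofreeSimplicial.hom_ext X fun p => ?_
    rw [assoc, assoc, cofreeSimplicial.map_π, cofreeSimplicial.lift_π, cofreeSimplicial.lift_π,
      ← X.map_comp]
    rfl

theorem isSplitMono_toCofreeSimplicial (X : SimplicialObject A) (n : SimplexCategoryᵒᵖ) :
    IsSplitMono ((toCofreeSimplicial X).app n) :=
  ⟨⟨⟨cofreeSimplicial.π X n ⟨n.unop, 𝟙 _⟩,
    (cofreeSimplicial.lift_π X n _ _).trans (X.map_id n)⟩⟩⟩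

/-- Cofree simplicial objects are contractible. -/
def cofreeSimplicialContraction [HasZeroMorphisms A] (X : SimplicialObject A) :
    SimplicialContraction (cofreeSimplicial X) where
  -- Keep the factor at `φ : k ⟶ n` exactly when `φ ≫ σ` sends vertex `0` to `0`. The test depends
  -- only on the composite to the interval, which gives naturality, and vertex `0` exists in every
  -- simplex.
  hom n σ := cofreeSimplicial.lift X n fun p =>
    if (p.2 ≫ σ).toOrderHom 0 = 0 then cofreeSimplicial.π X n p else 0
  naturality {m n} θ σ := by
    refine cofreeSimplicial.hom_ext X fun p => ?_
    rw [assoc, assoc, cofreeSimplicial.map_π, cofreeSimplicial.lift_π, cofreeSimplicial.lift_π]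
    simp only [assoc]
    split_ifs
    · rw [cofreeSimplicial.map_π]
    · rw [comp_zero]
  hom_zero n := by
    refine cofreeSimplicial.hom_ext X fun p => ?_
    rw [cofreeSimplicial.lift_π]
    exact (if_pos rfl).trans (id_comp _).symm
  hom_one n := by
    refine cofreeSimplicial.hom_ext X fun p => ?_
    rw [cofreeSimplicial.lift_π]
    exact (if_neg (by decide : ¬ (1 : Fin 2) = 0)).trans zero_comp.symm

end Contraction

/-! ### Hurewicz cofibrations and weak equivalences of simplicial objects -/

section SimplicialClasses

open Simplicial AlgebraicTopology

variable {A : Type u} [Category.{v} A] [Abelian A]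

theorem normalizedMooreComplex_map_comp_inclusion {X Y : SimplicialObject A} (f : X ⟶ Y) :
    (normalizedMooreComplex A).map f ≫ inclusionOfMooreComplexMap Y =
      inclusionOfMooreComplexMap X ≫ (alternatingFaceMapComplex A).map f :=
  (inclusionOfMooreComplex A).naturality f

instance : (normalizedMooreComplex A).Additive where
  map_add {X Y f g} := by
    rw [← cancel_mono (inclusionOfMooreComplexMap Y), Preadditive.add_comp,
      normalizedMooreComplex_map_comp_inclusion, normalizedMooreComplex_map_comp_inclusion,
      normalizedMooreComplex_map_comp_inclusion, Functor.map_add, Preadditive.comp_add]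

instance : (normalizedMooreComplex A).IsEquivalence :=
  inferInstanceAs (Abelian.DoldKan.equivalence (A := A)).functor.IsEquivalence

/-- The normalized complex is a natural retract of the simplicial object in every degree. -/
def normalizedRetractArrow {X Y : SimplicialObject A} (f : X ⟶ Y) (n : ℕ) :
    RetractArrow (((normalizedMooreComplex A).map f).f n) (f.app (op ⦋n⦌)) where
  i := Arrow.homMk ((inclusionOfMooreComplexMap X).f n) ((inclusionOfMooreComplexMap Y).f n)
    (by exact (HomologicalComplex.congr_hom (normalizedMooreComplex_map_comp_inclusion f) n).symm)
  r := Arrow.homMk ((DoldKan.PInftyToNormalizedMooreComplex X).f n)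
    ((DoldKan.PInftyToNormalizedMooreComplex Y).f n)
    (by exact (HomologicalComplex.congr_hom
      (DoldKan.PInftyToNormalizedMooreComplex_naturality f) n).symm)
  retract := by
    ext
    · exact HomologicalComplex.congr_hom (DoldKan.splitMonoInclusionOfMooreComplexMap X).id n
    · exact HomologicalComplex.congr_hom (DoldKan.splitMonoInclusionOfMooreComplexMap Y).id n

/-- Each degree of `Γ₀` is a finite sum of terms of the complex, and the map is diagonal for this
splitting. Retractions of the summands therefore suffice, with no compatibility with differentials.
-/
theorem isSplitMono_Γ₀_map_app {K L : ChainComplex A ℕ} (f : K ⟶ L)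
    (hf : ∀ n, IsSplitMono (f.f n)) (n : SimplexCategoryᵒᵖ) :
    IsSplitMono ((DoldKan.Γ₀.map f).app n) := by
  have hr : ∀ n, ∃ r : L.X n ⟶ K.X n, f.f n ≫ r = 𝟙 _ := fun n => ⟨retraction _, IsSplitMono.id _⟩
  choose r hr using hr
  refine ⟨⟨⟨(DoldKan.Γ₀.splitting L).desc n fun a => r a.1.unop.len ≫
    ((DoldKan.Γ₀.splitting K).cofan _).inj a, ?_⟩⟩⟩
  apply (DoldKan.Γ₀.splitting K).hom_ext'
  intro a
  change _ ≫ (DoldKan.Γ₀.splitting K).desc n _ ≫ _ = _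
  rw [SimplicialObject.Splitting.ι_desc_assoc]
  erw [assoc]
  erw [SimplicialObject.Splitting.ι_desc, reassoc_of% hr, comp_id]

/-- Hurewicz cofibrations of simplicial objects are the degreewise split monomorphisms. -/
theorem simplicialHurewicz_cof_iff {X Y : SimplicialObject A} (f : X ⟶ Y) :
    (simplicialHurewicz A).cof f ↔ ∀ n, IsSplitMono (f.app n) := by
  constructor
  · intro h n
    have h₁ := isSplitMono_Γ₀_map_app _ h n
    let e := (Abelian.DoldKan.equivalence (A := A)).unitIso
    refine isSplitMono_of_retractArrow (g := (DoldKan.Γ₀.map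
      ((Abelian.DoldKan.equivalence (A := A)).functor.map f)).app n) (h := ?_)
    exact
      { i := Arrow.homMk ((e.hom.app X).app n) ((e.hom.app Y).app n)
          (by exact (NatTrans.congr_app (e.hom.naturality f) n).symm)
        r := Arrow.homMk ((e.inv.app X).app n) ((e.inv.app Y).app n)
          (by exact (NatTrans.congr_app (e.inv.naturality f) n).symm)
        retract := by
          ext
          · exact NatTrans.congr_app (e.hom_inv_id_app X) n
          · exact NatTrans.congr_app (e.hom_inv_id_app Y) n }
  · intro h n
    have := h (op ⦋n⦌)
    exact isSplitMono_of_retractArrow (normalizedRetractArrow f n)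

theorem simplicialHurewicz_W_iff {X Y : SimplicialObject A} (f : X ⟶ Y) :
    (simplicialHurewicz A).W f ↔ HomologicalComplex.homotopyEquivalences A (ComplexShape.down ℕ)
      ((normalizedMooreComplex A).map f) := Iff.rfl

variable [HasProducts.{0} A] {C : Type u₁} [Category.{v₁} C] [Abelian C]
  (T : SimplicialObject A ⥤ SimplicialObject C)

/-- Since `N` is full and faithful, the extension of `N f` along the normalized cofree embedding
comes from a simplicial map. Thus `f` factors through a contractible object, and `T` preserves both
the factorization and the contractibility. -/
theorem nonempty_homotopy_zero_map
    (hT : ∀ X, SimplicialContraction X → Nonempty (SimplicialContraction (T.obj X)))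
    {X Y : SimplicialObject A} (f : X ⟶ Y) (h : Homotopy ((normalizedMooreComplex A).map f) 0) :
    Nonempty (Homotopy ((normalizedMooreComplex C).map (T.map f)) 0) := by
  obtain ⟨g, hg⟩ := exists_extension_of_homotopy_zero
    ((normalizedMooreComplex A).map (toCofreeSimplicial X))
    ((simplicialHurewicz_cof_iff _).2 (isSplitMono_toCofreeSimplicial X)) _ h
  obtain ⟨g, rfl⟩ := (normalizedMooreComplex A).map_surjective g
  rw [← Functor.map_comp] at hg
  obtain rfl := (normalizedMooreComplex A).map_injective hg
  obtain ⟨c⟩ := hT _ (cofreeSimplicialContraction X)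
  refine ⟨(Homotopy.ofEq ?_).trans (((c.normalizedHomotopy.compRight
    ((normalizedMooreComplex C).map (T.map g))).compLeft
      ((normalizedMooreComplex C).map (T.map (toCofreeSimplicial X)))).trans (Homotopy.ofEq ?_))⟩
  · rw [id_comp, ← Functor.map_comp, ← Functor.map_comp]
  · rw [zero_comp, comp_zero]

/-- An additive functor that preserves contractible simplicial objects preserves Hurewicz
weak equivalences. -/
theorem simplicialHurewicz_W_map [T.Additive]
    (hT : ∀ X, SimplicialContraction X → Nonempty (SimplicialContraction (T.obj X)))
    {X Y : SimplicialObject A} (f : X ⟶ Y) (hf : (simplicialHurewicz A).W f) :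
    (simplicialHurewicz C).W (T.map f) := by
  rw [simplicialHurewicz_W_iff] at hf ⊢
  obtain ⟨e, he⟩ := hf
  obtain ⟨g, hg⟩ := (normalizedMooreComplex A).map_surjective e.inv
  -- The homotopies of `e` live on normalized complexes, where `T` does not act. Only the
  -- null-homotopy of the differences from the identities is transferred.
  obtain ⟨h₁⟩ := nonempty_homotopy_zero_map T hT (f ≫ g - 𝟙 X)
    ((Homotopy.ofEq (by
      rw [Functor.map_sub, Functor.map_comp, CategoryTheory.Functor.map_id, hg, he])).trans
      (Homotopy.equivSubZero e.homotopyHomInvId))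
  obtain ⟨h₂⟩ := nonempty_homotopy_zero_map T hT (g ≫ f - 𝟙 Y)
    ((Homotopy.ofEq (by
      rw [Functor.map_sub, Functor.map_comp, CategoryTheory.Functor.map_id, hg, he])).trans
      (Homotopy.equivSubZero e.homotopyInvHomId))
  exact ⟨{
    hom := (normalizedMooreComplex C).map (T.map f)
    inv := (normalizedMooreComplex C).map (T.map g)
    homotopyHomInvId := Homotopy.equivSubZero.symm
      ((Homotopy.ofEq (by simp only [Functor.map_sub, Functor.map_comp,
        CategoryTheory.Functor.map_id])).trans h₁)
    homotopyInvHomId := Homotopy.equivSubZero.symm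
      ((Homotopy.ofEq (by simp only [Functor.map_sub, Functor.map_comp,
        CategoryTheory.Functor.map_id])).trans h₂) }, rfl⟩

end SimplicialClasses

/-! ### Pushout products of degreewise bifunctors -/

section PushoutProduct

variable {A : Type u₁} [Category.{v₁} A] {B : Type u₂} [Category.{v₂} B]
  {C : Type u₃} [Category.{v₃} C]

theorem CategoryTheory.Functor.PushoutObjObj.isSplitMono_ι [Preadditive C] {F : A ⥤ B ⥤ C}
    {X Y : A} {i : X ⟶ Y} {V W : B} {k : V ⟶ W} (sq : F.PushoutObjObj i k)
    [IsSplitMono i] [IsSplitMono k] : IsSplitMono sq.ι := by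
  have hi : (F.map i).app V ≫ (F.map (retraction i)).app V = 𝟙 _ := by
    rw [← NatTrans.comp_app, ← F.map_comp, IsSplitMono.id, F.map_id, NatTrans.id_app]
  have hi' : (F.map i).app W ≫ (F.map (retraction i)).app W = 𝟙 _ := by
    rw [← NatTrans.comp_app, ← F.map_comp, IsSplitMono.id, F.map_id, NatTrans.id_app]
  have hk : (F.obj X).map k ≫ (F.obj X).map (retraction k) = 𝟙 _ := by
    rw [← Functor.map_comp, IsSplitMono.id, Functor.map_id]
  have hk' : (F.obj Y).map k ≫ (F.obj Y).map (retraction k) = 𝟙 _ := by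
    rw [← Functor.map_comp, IsSplitMono.id, Functor.map_id]
  -- Inclusion-exclusion: retract onto each of the two pieces, and subtract the part over `F(X, V)`
  -- that is counted twice.
  refine ⟨⟨⟨(F.obj Y).map (retraction k) ≫ sq.inl + (F.map (retraction i)).app W ≫ sq.inr -
    (F.map (retraction i)).app W ≫ (F.obj X).map (retraction k) ≫ (F.map i).app V ≫ sq.inl, ?_⟩⟩⟩
  apply sq.hom_ext
  · rw [sq.inl_ι_assoc, comp_id, Preadditive.comp_sub, Preadditive.comp_add, reassoc_of% hk',
      NatTrans.naturality_assoc, NatTrans.naturality_assoc, reassoc_of% hk, sq.isPushout.w]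
    abel
  · rw [sq.inr_ι_assoc, comp_id, Preadditive.comp_sub, Preadditive.comp_add, reassoc_of% hi',
      reassoc_of% hi', ← NatTrans.naturality_assoc]
    abel

/-- The pushout product of a degreewise bifunctor in one degree. -/
def degreewisePushoutObjObj {F : A ⥤ B ⥤ C} {X Y : SimplicialObject A} {i : X ⟶ Y}
    {V W : SimplicialObject B} {k : V ⟶ W} (sq : (degreewise F).PushoutObjObj i k)
    [HasPushouts C] (n : SimplexCategoryᵒᵖ) : F.PushoutObjObj (i.app n) (k.app n) where
  pt := sq.pt.obj n
  inl := sq.inl.app n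
  inr := sq.inr.app n
  isPushout := sq.isPushout.map ((evaluation SimplexCategoryᵒᵖ C).obj n)
  ι := sq.ι.app n
  inl_ι := NatTrans.congr_app sq.inl_ι n
  inr_ι := NatTrans.congr_app sq.inr_ι n

theorem ModelClasses.PushoutProductAxiom.of_iso {D₁ : ModelClasses A} {D₂ : ModelClasses B}
    {D₃ : ModelClasses C} {F G : A ⥤ B ⥤ C} (h : PushoutProductAxiom D₁ D₂ D₃ F) (e : G ≅ F)
    [D₃.cof.RespectsIso] [D₃.W.RespectsIso] : PushoutProductAxiom D₁ D₂ D₃ G where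
  cof _ _ i _ _ k sq hi hk :=
    (D₃.cof.cancel_right_of_respectsIso sq.ι ((e.hom.app _).app _)).1 (h.cof i k (sq.ofNatIso e) hi hk)
  acyclic _ _ i _ _ k sq hi hk hw :=
    (D₃.W.cancel_right_of_respectsIso sq.ι ((e.hom.app _).app _)).1
      (h.acyclic i k (sq.ofNatIso e) hi hk hw)

variable [Abelian C] (F : A ⥤ B ⥤ C)

instance (X : SimplicialObject A) [Preadditive B] [∀ a, (F.obj a).Additive] :
    ((degreewise F).obj X).Additive where
  map_add {_ _ f g} := by
    ext n
    exact (F.obj (X.obj n)).map_add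

instance (K : SimplicialObject B) [Preadditive A] [∀ b, (F.flip.obj b).Additive] :
    ((degreewise F).flip.obj K).Additive where
  map_add {_ _ f g} := by
    ext n
    exact (F.flip.obj (K.obj n)).map_add

/-- A contraction of `K` induces one of the degreewise `F(X, K)`. -/
def degreewiseContraction [Preadditive B] [∀ a, (F.obj a).Additive] (X : SimplicialObject A)
    {K : SimplicialObject B} (c : SimplicialContraction K) :
    SimplicialContraction (((degreewise F).obj X).obj K) where
  hom n σ := (F.obj (X.obj n)).map (c.hom n σ)
  naturality θ σ := by
    dsimp [degreewise]
    rw [NatTrans.naturality_assoc, ← Functor.map_comp, c.naturality, Functor.map_comp, assoc]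
  hom_zero n := by
    rw [c.hom_zero]
    exact (F.obj _).map_id _
  hom_one n := by
    rw [c.hom_one]
    exact (F.obj _).map_zero _ _

/-- A contraction of `X` induces one of the degreewise `F(X, K)`. -/
def degreewiseFlipContraction [Preadditive A] [∀ b, (F.flip.obj b).Additive] {X : SimplicialObject A}
    (K : SimplicialObject B) (c : SimplicialContraction X) :
    SimplicialContraction (((degreewise F).flip.obj K).obj X) where
  hom n σ := (F.map (c.hom n σ)).app (K.obj n)
  naturality θ σ := by
    dsimp [degreewise]
    rw [← NatTrans.comp_app_assoc, ← Functor.map_comp, c.naturality, Functor.map_comp,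
      NatTrans.comp_app_assoc, assoc, NatTrans.naturality]
  hom_zero n := by
    rw [c.hom_zero]
    exact (F.flip.obj _).map_id _
  hom_one n := by
    rw [c.hom_one]
    exact (F.flip.obj _).map_zero _ _

theorem degreewise_W_map [Abelian B] [HasProducts.{0} B] [∀ a, (F.obj a).Additive]
    (X : SimplicialObject A)
    {K L : SimplicialObject B} (f : K ⟶ L) (hf : (simplicialHurewicz B).W f) :
    (simplicialHurewicz C).W (((degreewise F).obj X).map f) :=
  simplicialHurewicz_W_map _ (fun _ c => ⟨degreewiseContraction F X c⟩) f hf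

theorem degreewise_flip_W_map [Abelian A] [HasProducts.{0} A] [∀ b, (F.flip.obj b).Additive]
    {X Y : SimplicialObject A} (f : X ⟶ Y) (K : SimplicialObject B)
    (hf : (simplicialHurewicz A).W f) :
    (simplicialHurewicz C).W (((degreewise F).map f).app K) :=
  simplicialHurewicz_W_map ((degreewise F).flip.obj K)
    (fun _ c => ⟨degreewiseFlipContraction F K c⟩) f hf

instance : (simplicialHurewicz C).W.HasTwoOutOfThreeProperty :=
  inferInstanceAs ((HomologicalComplex.homotopyEquivalences C
    (ComplexShape.down ℕ)).inverseImage _).HasTwoOutOfThreeProperty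

instance : (simplicialHurewicz C).W.RespectsIso :=
  inferInstanceAs ((HomologicalComplex.homotopyEquivalences C
    (ComplexShape.down ℕ)).inverseImage _).RespectsIso

instance : (simplicialHurewicz C).cof.RespectsIso :=
  inferInstanceAs ((chainHurewicz C).cof.inverseImage _).RespectsIso

/-- The pushout of a Hurewicz trivial cofibration is a weak equivalence. -/
theorem simplicialHurewicz_W_of_isPushout {X Y Z P : SimplicialObject C} {f : X ⟶ Y} {g : X ⟶ Z}
    {f' : Z ⟶ P} {g' : Y ⟶ P} (sq : IsPushout g f f' g') (hf : (simplicialHurewicz C).cof f)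
    (hw : (simplicialHurewicz C).W f) : (simplicialHurewicz C).W f' := by
  -- In a model category trivial cofibrations are stable under pushout.
  let _ := simplicialModelCategory C
  exact (MorphismProperty.of_isPushout (P := HomotopicalAlgebra.trivialCofibrations _) sq
    ⟨hf, hw⟩).2

/-- The pushout-product axiom for the degreewise extension of a biadditive bifunctor. -/
theorem pushoutProductAxiom_degreewise [Abelian A] [Abelian B] [HasProducts.{0} A]
    [HasProducts.{0} B] [∀ a, (F.obj a).Additive] [∀ b, (F.flip.obj b).Additive] :
    ModelClasses.PushoutProductAxiom (simplicialHurewicz A) (simplicialHurewicz B)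
      (simplicialHurewicz C) (degreewise F) where
  cof X Y i V W k sq hi hk := by
    rw [simplicialHurewicz_cof_iff] at hi hk ⊢
    intro n
    have := hi n
    have := hk n
    exact (degreewisePushoutObjObj sq n).isSplitMono_ι
  acyclic X Y i V W k sq hi hk hw := by
    rw [simplicialHurewicz_cof_iff] at hi hk
    rcases hw with hw | hw
    · refine MorphismProperty.of_precomp (simplicialHurewicz C).W (W' := (simplicialHurewicz C).W) sq.inr _ ?_ ?_
      · refine simplicialHurewicz_W_of_isPushout sq.isPushout.flip ?_
          (degreewise_flip_W_map F i V hw)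
        rw [simplicialHurewicz_cof_iff]
        intro n
        have := hi n
        exact inferInstanceAs (IsSplitMono ((F.flip.obj (V.obj n)).map (i.app n)))
      · rw [sq.inr_ι]
        exact degreewise_flip_W_map F i W hw
    · refine MorphismProperty.of_precomp (simplicialHurewicz C).W (W' := (simplicialHurewicz C).W) sq.inl _ ?_ ?_
      · refine simplicialHurewicz_W_of_isPushout sq.isPushout ?_
          (degreewise_W_map F X k hw)
        rw [simplicialHurewicz_cof_iff]
        intro n
        have := hk n
        exact inferInstanceAs (IsSplitMono ((F.obj (X.obj n)).map (k.app n)))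
      · rw [sq.inl_ι]
        exact degreewise_W_map F Y k hw

end PushoutProduct

/-! ### Monoidal model categories of simplicial objects -/

section Monoidal

variable {A : Type u} [Category.{v} A] [MonoidalCategory A]

/-- The tensor product of simplicial objects is degreewise. -/
def curriedTensorIsoDegreewise :
    curriedTensor (SimplicialObject A) ≅ degreewise (curriedTensor A) :=
  NatIso.ofComponents (fun X => NatIso.ofComponents (fun Y =>
    NatIso.ofComponents (fun n => Iso.refl _) (fun φ => by
      refine (comp_id _).trans (Eq.trans ?_ (id_comp _).symm)
      exact MonoidalCategory.tensorHom_def _ _)) (fun f => by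
        ext n
        exact (comp_id _).trans (id_comp _).symm)) (fun f => by
        ext Y n
        exact (comp_id _).trans (id_comp _).symm)

theorem simplicialHurewicz_isMonoidalModelCategory [Abelian A] [HasLimits A] [HasColimits A]
    [HasProducts.{0} A] [SymmetricCategory A] [MonoidalClosed (SimplicialObject A)]
    [∀ a : A, ((curriedTensor A).obj a).Additive]
    [∀ a : A, ((curriedTensor A).flip.obj a).Additive] :
    (simplicialHurewicz A).IsMonoidalModelCategory where
  isModelCategory := simplicialHurewicz_isModelCategory
  pushoutProduct := (pushoutProductAxiom_degreewise (curriedTensor A)).of_iso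
    curriedTensorIsoDegreewise
  unit X Q q _ _ hq := by
    refine ((simplicialHurewicz A).W.cancel_right_of_respectsIso (X ◁ q) (ρ_ X).hom).2 ?_
    let e := curriedTensorIsoDegreewise.app X
    refine ((simplicialHurewicz A).W.cancel_right_of_respectsIso (X ◁ q) (e.hom.app _)).1 ?_
    have h : X ◁ q ≫ e.hom.app _ = e.hom.app Q ≫ _ := e.hom.naturality q
    rw [h]
    exact ((simplicialHurewicz A).W.cancel_left_of_respectsIso (e.hom.app Q) _).2
      (degreewise_W_map (curriedTensor A) X q hq)

instance (M : AddCommGrpCat.{u}) : ((curriedTensor AddCommGrpCat.{u}).obj M).Additive where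
  map_add := AbTensor.hom_ext fun _ _ => TensorProduct.tmul_add _ _ _

instance (M : AddCommGrpCat.{u}) : ((curriedTensor AddCommGrpCat.{u}).flip.obj M).Additive where
  map_add := AbTensor.hom_ext fun _ _ => TensorProduct.add_tmul _ _ _

theorem simplicialAb_isMonoidalModelCategory :
    (simplicialHurewicz AddCommGrpCat.{u}).IsMonoidalModelCategory :=
  simplicialHurewicz_isMonoidalModelCategory

instance (R : Type u) [CommRing R] (M : ModuleCat.{u} R) :
    ((curriedTensor (ModuleCat.{u} R)).obj M).Additive :=
  inferInstanceAs (tensorLeft M).Additive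

instance (R : Type u) [CommRing R] (M : ModuleCat.{u} R) :
    ((curriedTensor (ModuleCat.{u} R)).flip.obj M).Additive :=
  inferInstanceAs (tensorRight M).Additive

theorem simplicialMod_isMonoidalModelCategory (R : Type u) [CommRing R] :
    (simplicialHurewicz (ModuleCat.{u} R)).IsMonoidalModelCategory :=
  simplicialHurewicz_isMonoidalModelCategory

instance (R : Type u) [Ring R] (M : ModuleCat.{u} R) : ((modTensorAb R).obj M).Additive where
  map_add {_ _ f g} := by
    ext : 1
    exact TensorProduct.AlgebraTensorModule.ext fun _ _ => TensorProduct.tmul_add _ _ _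

instance (R : Type u) [Ring R] (K : AddCommGrpCat.{u}) :
    ((modTensorAb R).flip.obj K).Additive where
  map_add {_ _ f g} := by
    ext : 1
    exact TensorProduct.AlgebraTensorModule.ext fun _ _ => TensorProduct.add_tmul _ _ _

end Monoidal

/-! ### The tensor product of a module and an abelian group -/

namespace ModTensorAb

open scoped TensorProduct

variable {R : Type u} [Ring R]

theorem hom_ext {M : ModuleCat.{u} R} {K : AddCommGrpCat.{u}} {N : ModuleCat.{u} R}
    {f g : ((modTensorAb R).obj M).obj K ⟶ N}
    (h : ∀ (m : M) (k : K), f.hom (m ⊗ₜ[ℤ] k) = g.hom (m ⊗ₜ[ℤ] k)) : f = g := by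
  ext : 1
  exact TensorProduct.AlgebraTensorModule.ext h

/-- The map out of a tensor product associated with a homomorphism to a group of linear maps. -/
def desc {M : ModuleCat.{u} R} {K : AddCommGrpCat.{u}} {N : ModuleCat.{u} R}
    (f : K →+ (M ⟶ N)) : ((modTensorAb R).obj M).obj K ⟶ N :=
  ModuleCat.ofHom (TensorProduct.AlgebraTensorModule.lift
    { toFun m := ((AddMonoidHom.mk' (fun k => (f k).hom m) fun k k' => by
        simp).toIntLinearMap : K →ₗ[ℤ] N)
      map_add' m m' := by
        ext k
        exact map_add (f k).hom m m'
      map_smul' r m := by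
        ext k
        exact map_smul (f k).hom r m })

/-- The homomorphism to a group of linear maps associated with a map out of a tensor product. -/
def curry {M : ModuleCat.{u} R} {K : AddCommGrpCat.{u}} {N : ModuleCat.{u} R}
    (f : ((modTensorAb R).obj M).obj K ⟶ N) : K →+ (M ⟶ N) :=
  AddMonoidHom.mk' (fun k => ModuleCat.ofHom
    { toFun m := f.hom (m ⊗ₜ[ℤ] k)
      map_add' m m' := (congrArg f.hom (TensorProduct.add_tmul m m' k)).trans (map_add f.hom _ _)
      map_smul' r m := (f.hom.map_smul r (m ⊗ₜ[ℤ] k)) }) fun k k' => by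
        ext m
        exact (congrArg f.hom (TensorProduct.tmul_add m k k')).trans (map_add f.hom _ _)

variable (R) in
/-- The associativity isomorphism. -/
def assocIso (M : ModuleCat.{u} R) (K L : AddCommGrpCat.{u}) :
    ((modTensorAb R).obj (((modTensorAb R).obj M).obj K)).obj L ≅
      ((modTensorAb R).obj M).obj (K ⊗ L) :=
  (TensorProduct.AlgebraTensorModule.assoc ℤ ℤ R M K L).toModuleIso

theorem linearMap_ext₃ {M K L N : Type*} [AddCommGroup M] [Module R M] [AddCommGroup K]
    [AddCommGroup L] [AddCommGroup N] [Module R N] {f g : (M ⊗[ℤ] K) ⊗[ℤ] L →ₗ[R] N}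
    (h : ∀ (m : M) (k : K) (l : L), f ((m ⊗ₜ[ℤ] k) ⊗ₜ[ℤ] l) = g ((m ⊗ₜ[ℤ] k) ⊗ₜ[ℤ] l)) :
    f = g := by
  refine TensorProduct.AlgebraTensorModule.ext fun x l => ?_
  induction x using TensorProduct.induction_on with
  | zero => simp only [TensorProduct.zero_tmul, map_zero]
  | tmul m k => exact h m k l
  | add x y hx hy => simp only [TensorProduct.add_tmul, map_add, hx, hy]

theorem hom_ext₃ {M : ModuleCat.{u} R} {K L : AddCommGrpCat.{u}} {N : ModuleCat.{u} R}
    {f g : ((modTensorAb R).obj (((modTensorAb R).obj M).obj K)).obj L ⟶ N}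
    (h : ∀ (m : M) (k : K) (l : L),
      f.hom ((m ⊗ₜ[ℤ] k) ⊗ₜ[ℤ] l) = g.hom ((m ⊗ₜ[ℤ] k) ⊗ₜ[ℤ] l)) : f = g := by
  ext : 1
  exact linearMap_ext₃ h

variable (R) in
/-- The right unit isomorphism. -/
def unitIso (M : ModuleCat.{u} R) : ((modTensorAb R).obj M).obj (𝟙_ AddCommGrpCat.{u}) ≅ M :=
  ((TensorProduct.AlgebraTensorModule.congr (LinearEquiv.refl R M)
    (ULift.moduleEquiv : ULift.{u} ℤ ≃ₗ[ℤ] ℤ)).trans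
      (TensorProduct.AlgebraTensorModule.rid ℤ R M)).toModuleIso

end ModTensorAb

/-! ### The enrichment of simplicial modules -/

namespace SModEnriched

open Enriched.FunctorCategory
open scoped TensorProduct

variable {R : Type u} [Ring R]

/-! ### Components of the end defining the enriched hom. -/

section Evaluation

theorem precompEnrichedHom'_π {J K : Type*} [Category* J] [Category* K] {V C : Type*} [Category* V]
    [MonoidalCategory V] [Category* C] [EnrichedOrdinaryCategory V C] {F₁ F₂ : J ⥤ C} (G : K ⥤ J)
    [HasEnrichedHom V F₁ F₂] {F₁' F₂' : K ⥤ C} [HasEnrichedHom V F₁' F₂'] (e₁ : G ⋙ F₁ ≅ F₁')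
    (e₂ : G ⋙ F₂ ≅ F₂') (k : K) :
    precompEnrichedHom' V G e₁ e₂ ≫ enrichedHomπ V F₁' F₂' k = enrichedHomπ V F₁ F₂ (G.obj k) ≫
      eHomWhiskerRight V (e₁.inv.app k) _ ≫ eHomWhiskerLeft V _ (e₂.hom.app k) := by
  delta precompEnrichedHom'
  generalize_proofs hf
  exact end_.lift_π _ hf k

variable (A B : SimplicialObject (ModuleCat.{u} R))

/-- The simplicial abelian group of maps from `A` to `B`. -/
abbrev sHom : SimplicialObject AddCommGrpCat.{u} :=
  A ⟶[SimplicialObject AddCommGrpCat.{u}] B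

/-- The component of a family indexed by a map `θ` of `SimplexCategoryᵒᵖ`. -/
def proj {m n : SimplexCategoryᵒᵖ} (θ : m ⟶ n) :
    (sHom A B).obj m ⟶ (A.obj n ⟶[AddCommGrpCat.{u}] B.obj n) :=
  enrichedHomπ AddCommGrpCat.{u} (Under.forget m ⋙ A) (Under.forget m ⋙ B) (Under.mk θ)

theorem map_proj {l m n : SimplexCategoryᵒᵖ} (φ : l ⟶ m) (θ : m ⟶ n) :
    (sHom A B).map φ ≫ proj A B θ = proj A B (φ ≫ θ) := by
  refine (precompEnrichedHom'_π _ _ _ (Under.mk θ)).trans ?_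
  -- The comparison isomorphisms in the restriction are identities, so whiskering by them
  -- disappears.
  change proj A B (φ ≫ θ) ≫ eHomWhiskerRight _ (𝟙 (A.obj n)) _ ≫
    eHomWhiskerLeft _ _ (𝟙 (B.obj n)) = _
  rw [eHomWhiskerRight_id, eHomWhiskerLeft_id, comp_id, comp_id]

theorem proj_naturality {l m n : SimplexCategoryᵒᵖ} (φ : l ⟶ m) (θ : m ⟶ n) :
    proj A B φ ≫ eHomWhiskerLeft AddCommGrpCat.{u} (A.obj m) (B.map θ) =
      proj A B (φ ≫ θ) ≫ eHomWhiskerRight AddCommGrpCat.{u} (A.map θ) (B.obj n) :=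
  enrichedHom_condition AddCommGrpCat.{u} (Under.forget l ⋙ A) (Under.forget l ⋙ B)
    (Under.homMk θ : Under.mk φ ⟶ Under.mk (φ ≫ θ))

variable {A B} in
theorem hom_ext {K : AddCommGrpCat.{u}} {m : SimplexCategoryᵒᵖ} {f g : K ⟶ (sHom A B).obj m}
    (h : ∀ {n} (θ : m ⟶ n), f ≫ proj A B θ = g ≫ proj A B θ) : f = g :=
  end_.hom_ext fun θ => h θ.hom

variable {A B} in
/-- A family of maps compatible with the simplicial structure. -/
def lift {K : AddCommGrpCat.{u}} {m : SimplexCategoryᵒᵖ}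
    (f : ∀ {n} (_ : m ⟶ n), K ⟶ (A.obj n ⟶[AddCommGrpCat.{u}] B.obj n))
    (hf : ∀ {n p} (φ : m ⟶ n) (θ : n ⟶ p),
      f φ ≫ eHomWhiskerLeft AddCommGrpCat.{u} (A.obj n) (B.map θ) =
        f (φ ≫ θ) ≫ eHomWhiskerRight AddCommGrpCat.{u} (A.map θ) (B.obj p)) :
    K ⟶ (sHom A B).obj m :=
  end_.lift (fun θ => f θ.hom) fun θ θ' φ => by
    have := hf θ.hom φ.right
    rw [Under.w] at this
    exact this

variable {A B} in
theorem lift_proj {K : AddCommGrpCat.{u}} {m : SimplexCategoryᵒᵖ}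
    (f : ∀ {n} (_ : m ⟶ n), K ⟶ (A.obj n ⟶[AddCommGrpCat.{u}] B.obj n)) (hf) {n} (θ : m ⟶ n) :
    lift f hf ≫ proj A B θ = f θ :=
  end_.lift_π _ _ _

theorem eComp_proj (D : SimplicialObject (ModuleCat.{u} R)) {m n : SimplexCategoryᵒᵖ} (θ : m ⟶ n) :
    (eComp (SimplicialObject AddCommGrpCat.{u}) A B D).app m ≫ proj A D θ =
      (proj A B θ ⊗ₘ proj B D θ) ≫ eComp AddCommGrpCat.{u} _ _ _ :=
  enrichedComp_π _ _ _ _ _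

variable {A B} in
theorem eHomEquiv_proj (f : A ⟶ B) {m n : SimplexCategoryᵒᵖ} (θ : m ⟶ n) :
    (eHomEquiv (SimplicialObject AddCommGrpCat.{u}) f).app m ≫ proj A B θ =
      eHomEquiv AddCommGrpCat.{u} (f.app n) := by
  refine (assoc _ _ _).trans ((congrArg _ (precompEnrichedHom'_π _ _ _ (Under.mk θ))).trans ?_)
  change homEquiv AddCommGrpCat.{u} f ≫ enrichedHomπ _ A B n ≫
    eHomWhiskerRight _ (𝟙 (A.obj n)) _ ≫ eHomWhiskerLeft _ _ (𝟙 (B.obj n)) = _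
  rw [eHomWhiskerRight_id, eHomWhiskerLeft_id, comp_id, comp_id]
  exact homEquiv_apply_π _ f n

end Evaluation

/-! ### Simplices of the enriched hom and the tensor-hom bijection. -/

section Elements

/-- A morphism `f` corresponds to `n ↦ n • f` on the unit, and whiskering evaluates it at `1`. -/
theorem eHomWhiskerLeft_apply {M N N' : ModuleCat.{u} R} (f : N ⟶ N') (x : M ⟶ N) :
    (eHomWhiskerLeft AddCommGrpCat.{u} M f).hom x = x ≫ f := by
  change x ≫ ((1 : ℤ) • f) = x ≫ f
  rw [one_zsmul]

theorem eHomWhiskerRight_apply {M M' N : ModuleCat.{u} R} (f : M ⟶ M') (x : M' ⟶ N) :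
    (eHomWhiskerRight AddCommGrpCat.{u} f N).hom x = f ≫ x := by
  change ((1 : ℤ) • f) ≫ x = f ≫ x
  rw [one_zsmul]

variable {A B D : SimplicialObject (ModuleCat.{u} R)}

/-- The component of an `n`-simplex of the simplicial abelian group of maps at `θ`. -/
def app {m n : SimplexCategoryᵒᵖ} (x : (sHom A B).obj m) (θ : m ⟶ n) : A.obj n ⟶ B.obj n :=
  (proj A B θ).hom x

theorem app_map {l m n : SimplexCategoryᵒᵖ} (φ : l ⟶ m) (x : (sHom A B).obj l) (θ : m ⟶ n) :
    app ((sHom A B).map φ x) θ = app x (φ ≫ θ) :=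
  ConcreteCategory.congr_hom (map_proj A B φ θ) x

theorem app_naturality {l m n : SimplexCategoryᵒᵖ} (x : (sHom A B).obj l) (φ : l ⟶ m)
    (θ : m ⟶ n) : app x φ ≫ B.map θ = A.map θ ≫ app x (φ ≫ θ) := by
  have h := ConcreteCategory.congr_hom (proj_naturality A B φ θ) x
  exact (eHomWhiskerLeft_apply _ _).symm.trans (h.trans (eHomWhiskerRight_apply _ _))

theorem app_eComp {m n : SimplexCategoryᵒᵖ} (x : (sHom A B).obj m) (y : (sHom B D).obj m)
    (θ : m ⟶ n) : app ((eComp (SimplicialObject AddCommGrpCat.{u}) A B D).app m (x ⊗ₜ[ℤ] y)) θ =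
      app x θ ≫ app y θ :=
  ConcreteCategory.congr_hom (eComp_proj A B D θ) (x ⊗ₜ[ℤ] y)

theorem app_eHomEquiv (f : A ⟶ B) {m n : SimplexCategoryᵒᵖ} (k : ULift.{u} ℤ) (θ : m ⟶ n) :
    app ((eHomEquiv (SimplicialObject AddCommGrpCat.{u}) f).app m k) θ = k.down • f.app n :=
  ConcreteCategory.congr_hom (eHomEquiv_proj f θ) k

theorem app_eId {m n : SimplexCategoryᵒᵖ} (k : ULift.{u} ℤ) (θ : m ⟶ n) :
    app ((eId (SimplicialObject AddCommGrpCat.{u}) A).app m k) θ = k.down • 𝟙 (A.obj n) := by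
  rw [← eHomEquiv_id, app_eHomEquiv]
  rfl

theorem app_eHomWhiskerLeft (f : B ⟶ D) {m n : SimplexCategoryᵒᵖ} (x : (sHom A B).obj m)
    (θ : m ⟶ n) :
    app ((eHomWhiskerLeft (SimplicialObject AddCommGrpCat.{u}) A f).app m x) θ =
      app x θ ≫ f.app n := by
  refine (app_eComp x ((eHomEquiv (SimplicialObject AddCommGrpCat.{u}) f).app m ⟨1⟩) θ).trans ?_
  rw [app_eHomEquiv, one_zsmul]

theorem app_eHomWhiskerRight (f : A ⟶ B) {m n : SimplexCategoryᵒᵖ} (x : (sHom B D).obj m)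
    (θ : m ⟶ n) :
    app ((eHomWhiskerRight (SimplicialObject AddCommGrpCat.{u}) f D).app m x) θ =
      f.app n ≫ app x θ := by
  refine (app_eComp ((eHomEquiv (SimplicialObject AddCommGrpCat.{u}) f).app m ⟨1⟩) x θ).trans ?_
  rw [app_eHomEquiv, one_zsmul]

/-- Maps to the simplicial abelian group of maps are maps out of the tensor product. -/
def uncurry {L : SimplicialObject AddCommGrpCat.{u}} (g : L ⟶ sHom A B) :
    ((sModTensor R).obj A).obj L ⟶ B where
  app n := ModTensorAb.desc ((proj A B (𝟙 n)).hom.comp (g.app n).hom)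
  naturality m n θ := by
    refine ModTensorAb.hom_ext fun a l => ?_
    change (app (g.app n (L.map θ l)) (𝟙 n)).hom (A.map θ a) =
      B.map θ ((app (g.app m l) (𝟙 m)).hom a)
    have h₁ := ConcreteCategory.congr_hom (g.naturality θ) l
    have h₂ := ConcreteCategory.congr_hom (app_naturality (g.app m l) (𝟙 m) θ) a
    refine Eq.trans ?_ h₂.symm
    change _ = (app (g.app m l) (𝟙 m ≫ θ)).hom (A.map θ a)
    -- The component at `θ` becomes the identity component of the restriction along `θ`, where
    -- naturality of `g` applies.
    rw [id_comp, ← comp_id θ, ← app_map, comp_id]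
    exact congrArg (fun x => (app x (𝟙 n)).hom (A.map θ a)) h₁

theorem uncurry_app_tmul {L : SimplicialObject AddCommGrpCat.{u}} (g : L ⟶ sHom A B)
    (n : SimplexCategoryᵒᵖ) (a : A.obj n) (l : L.obj n) :
    ((uncurry g).app n).hom (a ⊗ₜ[ℤ] l) = (app (g.app n l) (𝟙 n)).hom a := rfl

theorem sTensor_hom_ext {L : SimplicialObject AddCommGrpCat.{u}}
    {f g : ((sModTensor R).obj A).obj L ⟶ B}
    (h : ∀ n (a : A.obj n) (l : L.obj n),
      (f.app n).hom (a ⊗ₜ[ℤ] l) = (g.app n).hom (a ⊗ₜ[ℤ] l)) : f = g := by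
  exact NatTrans.ext (funext fun n => ModTensorAb.hom_ext (h n))

/-- Maps out of the tensor product are maps to the simplicial abelian group of maps. -/
def curry {L : SimplicialObject AddCommGrpCat.{u}} (f : ((sModTensor R).obj A).obj L ⟶ B) :
    L ⟶ sHom A B where
  app m := lift (fun {n} θ => L.map θ ≫ AddCommGrpCat.ofHom (ModTensorAb.curry (f.app n)))
    (fun {n p} φ θ => by
      ext l
      refine (eHomWhiskerLeft_apply _ _).trans (Eq.trans ?_ (eHomWhiskerRight_apply _ _).symm)
      refine ModuleCat.hom_ext (LinearMap.ext fun a => ?_)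
      change B.map θ ((f.app n).hom (a ⊗ₜ[ℤ] (L.map φ l))) =
        (f.app p).hom (A.map θ a ⊗ₜ[ℤ] L.map (φ ≫ θ) l)
      rw [L.map_comp]
      exact (ConcreteCategory.congr_hom (f.naturality θ) (a ⊗ₜ[ℤ] L.map φ l)).symm)
  naturality l m φ := by
    refine hom_ext fun θ => ?_
    rw [assoc, assoc, map_proj, lift_proj, lift_proj, L.map_comp, assoc]

theorem app_curry {L : SimplicialObject AddCommGrpCat.{u}}
    (f : ((sModTensor R).obj A).obj L ⟶ B) {m n : SimplexCategoryᵒᵖ} (l : L.obj m) (θ : m ⟶ n)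
    (a : A.obj n) : (app ((curry f).app m l) θ).hom a = (f.app n).hom (a ⊗ₜ[ℤ] L.map θ l) :=
  congrArg (fun x : A.obj n ⟶ B.obj n => x.hom a)
    (ConcreteCategory.congr_hom (lift_proj _ _ θ) l)

theorem uncurry_curry {L : SimplicialObject AddCommGrpCat.{u}}
    (f : ((sModTensor R).obj A).obj L ⟶ B) : uncurry (curry f) = f := by
  refine sTensor_hom_ext (R := R) fun n a l => ?_
  rw [uncurry_app_tmul, app_curry, L.map_id]
  rfl

theorem uncurry_injective {L : SimplicialObject AddCommGrpCat.{u}} :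
    Function.Injective (uncurry : (L ⟶ sHom A B) → (((sModTensor R).obj A).obj L ⟶ B)) := by
  intro g g' h
  refine NatTrans.ext (funext fun m => hom_ext (R := R) fun {n} θ => ?_)
  ext l
  change app (g.app m l) θ = app (g'.app m l) θ
  -- As in Yoneda, the component at `θ` is the identity component after restriction along `θ`, and
  -- `uncurry` records exactly the identity components.
  have key : ∀ g : L ⟶ sHom A B, app (g.app m l) θ = app (g.app n (L.map θ l)) (𝟙 n) := by
    intro g
    have h₁ := ConcreteCategory.congr_hom (g.naturality θ) l
    refine Eq.trans ?_ (congrArg (fun x => app x (𝟙 n)) h₁).symm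
    exact (congrArg _ (comp_id θ).symm).trans (app_map θ _ (𝟙 n)).symm
  rw [key, key]
  refine ModuleCat.hom_ext (LinearMap.ext fun a => ?_)
  rw [← uncurry_app_tmul, ← uncurry_app_tmul, h]

/-- Maps to the simplicial abelian group of maps are maps out of the tensor product. -/
def uncurryEquiv (L : SimplicialObject AddCommGrpCat.{u})
    (A B : SimplicialObject (ModuleCat.{u} R)) :
    (L ⟶ sHom A B) ≃ (((sModTensor R).obj A).obj L ⟶ B) where
  toFun := uncurry (R := R)
  invFun := curry (R := R)
  left_inv _ := uncurry_injective (uncurry_curry (R := R) _)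
  right_inv := uncurry_curry (R := R)

end Elements

/-! ### The degreewise tensoring. -/

section Tensor

variable {A A' B D : SimplicialObject (ModuleCat.{u} R)} {K L : SimplicialObject AddCommGrpCat.{u}}

theorem uncurry_comp (k : K ⟶ L) (g : L ⟶ sHom A B) :
    uncurry (k ≫ g) = ((sModTensor R).obj A).map k ≫ uncurry g :=
  sTensor_hom_ext (R := R) fun _ _ _ => rfl

theorem uncurry_comp_eHomWhiskerLeft (g : K ⟶ sHom A B) (f : B ⟶ D) :
    uncurry (g ≫ eHomWhiskerLeft (SimplicialObject AddCommGrpCat.{u}) A f) = uncurry g ≫ f :=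
  sTensor_hom_ext (R := R) fun n a k =>
    congrArg (fun x : A.obj n ⟶ D.obj n => x.hom a) (app_eHomWhiskerLeft f (g.app n k) (𝟙 n))

theorem uncurry_comp_eHomWhiskerRight (f : A ⟶ A') (g : K ⟶ sHom A' B) :
    uncurry (g ≫ eHomWhiskerRight (SimplicialObject AddCommGrpCat.{u}) f B) =
      ((sModTensor R).map f).app K ≫ uncurry g :=
  sTensor_hom_ext (R := R) fun n a k =>
    congrArg (fun x : A.obj n ⟶ B.obj n => x.hom a) (app_eHomWhiskerRight f (g.app n k) (𝟙 n))

/-- The associativity isomorphism. -/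
def assocIso (A : SimplicialObject (ModuleCat.{u} R)) (K L : SimplicialObject AddCommGrpCat.{u}) :
    ((sModTensor R).obj (((sModTensor R).obj A).obj K)).obj L ≅
      ((sModTensor R).obj A).obj (K ⊗ L) :=
  NatIso.ofComponents (fun n => ModTensorAb.assocIso R (A.obj n) (K.obj n) (L.obj n))
    fun _ => ModTensorAb.hom_ext₃ fun _ _ _ => rfl

theorem uncurry_eComp (x : K ⟶ sHom A B) (y : L ⟶ sHom B D) :
    uncurry ((x ⊗ₘ y) ≫ eComp (SimplicialObject AddCommGrpCat.{u}) A B D) =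
      (assocIso A K L).inv ≫ ((sModTensor R).map (uncurry x)).app L ≫ uncurry y := by
  rw [Iso.eq_inv_comp]
  refine NatTrans.ext (funext fun n => ModTensorAb.hom_ext₃ fun a k l => ?_)
  exact congrArg (fun x : A.obj n ⟶ D.obj n => x.hom a) (app_eComp (x.app n k) (y.app n l) (𝟙 n))

/-- The right unit isomorphism. -/
def unitIso (A : SimplicialObject (ModuleCat.{u} R)) :
    ((sModTensor R).obj A).obj (𝟙_ (SimplicialObject AddCommGrpCat.{u})) ≅ A :=
  NatIso.ofComponents (fun n => ModTensorAb.unitIso R (A.obj n))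
    fun φ => ModTensorAb.hom_ext fun a k => (map_zsmul (A.map φ).hom k.down a).symm

theorem uncurry_eId : uncurry (eId (SimplicialObject AddCommGrpCat.{u}) A) = (unitIso A).hom :=
  sTensor_hom_ext (R := R) fun n a k =>
    congrArg (fun x : A.obj n ⟶ A.obj n => x.hom a) (app_eId k (𝟙 n))

/-- By Yoneda, test on `L`. Through the tensor-hom bijections the comparison becomes precomposition
with `A ⊗ (K ⊗ L) ≅ (A ⊗ K) ⊗ L ≅ T ⊗ L`, where `T` is the target `B` of `uncurry η`. -/
theorem isIso_tensorComparison (η : K ⟶ sHom A B) [IsIso (uncurry η)]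
    (D : SimplicialObject (ModuleCat.{u} R)) :
    IsIso (tensorComparison (SimplicialObject AddCommGrpCat.{u}) η D) := by
  refine isIso_of_yoneda_map_bijective _ fun L => ?_
  have h : (fun x : L ⟶ sHom B D =>
      x ≫ tensorComparison (SimplicialObject AddCommGrpCat.{u}) η D) =
      MonoidalClosed.curry ∘ (uncurryEquiv (K ⊗ L) A D).symm ∘
        fun x => (assocIso A K L).inv ≫ ((sModTensor R).map (uncurry η)).app L ≫ uncurry x := by
    funext x
    dsimp only [Function.comp_apply]
    rw [← uncurry_eComp]
    refine Eq.trans ?_ (congrArg _ ((uncurryEquiv (K ⊗ L) A D).symm_apply_apply _).symm)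
    rw [tensorComparison, ← MonoidalClosed.curry_natural_left, tensorHom_def', assoc]
  have : IsIso (((sModTensor R).map (uncurry η)).app L) := inferInstance
  rw [h]
  exact ((ihom.adjunction _).homEquiv _ _).bijective.comp ((Equiv.bijective _).comp
    ((assocIso A K L).homFromEquiv.bijective.comp
      ((asIso (((sModTensor R).map (uncurry η)).app L)).symm.homFromEquiv.bijective.comp
        (uncurryEquiv L B D).bijective)))

variable (R) in
/-- The degreewise tensor product is a tensoring of simplicial modules. -/
def tensoring : Tensoring (SimplicialObject AddCommGrpCat.{u}) (sModTensor R) where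
  η A K := curry (𝟙 (((sModTensor R).obj A).obj K))
  naturality {K L} A k := by
    apply uncurry_injective
    rw [uncurry_comp, uncurry_comp_eHomWhiskerLeft, uncurry_curry, uncurry_curry, comp_id, id_comp]
  dinaturality f K := by
    apply uncurry_injective
    rw [uncurry_comp_eHomWhiskerLeft, uncurry_comp_eHomWhiskerRight, uncurry_curry, uncurry_curry,
      comp_id, id_comp]
  isIso_comparison A K B := by
    have : IsIso (uncurry (curry (𝟙 (((sModTensor R).obj A).obj K)))) := by
      rw [uncurry_curry]
      infer_instance
    exact isIso_tensorComparison _ B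
  ρ := unitIso
  η_ρ A := by
    apply uncurry_injective
    rw [uncurry_comp_eHomWhiskerLeft, uncurry_curry, id_comp, uncurry_eId]

end Tensor

/-! ### Cotensors by simplicial abelian groups. -/

section Cotensor

variable (K : SimplicialObject AddCommGrpCat.{u}) (B : SimplicialObject (ModuleCat.{u} R))

/-- The `n`-simplices of the cotensor: the families of homomorphisms `K_m → B_m`, indexed by the
maps from `n` to `m` in `SimplexCategoryᵒᵖ`, compatible with the simplicial structure. -/
def cotensorFamilies (n : SimplexCategoryᵒᵖ) :
    Submodule R (∀ p : Σ m : SimplexCategoryᵒᵖ, (n ⟶ m), K.obj p.1 →+ B.obj p.1) where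
  carrier := {f | ∀ {m q : SimplexCategoryᵒᵖ} (φ : n ⟶ m) (θ : m ⟶ q) (k : K.obj m),
    f ⟨q, φ ≫ θ⟩ (K.map θ k) = B.map θ (f ⟨m, φ⟩ k)}
  add_mem' hf hg _ _ φ θ k := (congrArg₂ (· + ·) (hf φ θ k) (hg φ θ k)).trans
    (map_add (B.map θ).hom _ _).symm
  zero_mem' {_ _} _ θ _ := (map_zero (B.map θ).hom).symm
  smul_mem' r _ hf _ _ φ θ k := (congrArg (r • ·) (hf φ θ k)).trans
    (map_smul (B.map θ).hom r _).symm

variable {K B} in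
/-- Restriction of a compatible family along a map. -/
def cotensorRestrict {n n' : SimplexCategoryᵒᵖ} (ψ : n ⟶ n') :
    cotensorFamilies K B n →ₗ[R] cotensorFamilies K B n' where
  toFun f := ⟨fun p => f.1 ⟨p.1, ψ ≫ p.2⟩, fun {m q} φ θ k => by
    have h := f.2 (ψ ≫ φ) θ k
    rwa [assoc] at h⟩
  map_add' _ _ := rfl
  map_smul' _ _ := rfl

/-- The cotensor of a simplicial module by a simplicial abelian group. -/
def cotensor : SimplicialObject (ModuleCat.{u} R) where
  obj n := ModuleCat.of R (cotensorFamilies K B n)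
  map ψ := ModuleCat.ofHom (cotensorRestrict ψ)
  map_id n := ModuleCat.hom_ext (LinearMap.ext fun f : cotensorFamilies K B n =>
    Subtype.ext (funext fun p => by
      change f.1 ⟨p.1, 𝟙 n ≫ p.2⟩ = f.1 p
      rw [id_comp]))
  map_comp {n _ _} ψ ψ' := ModuleCat.hom_ext (LinearMap.ext fun f : cotensorFamilies K B n =>
    Subtype.ext (funext fun p => by
      change f.1 ⟨p.1, (ψ ≫ ψ') ≫ p.2⟩ = f.1 ⟨p.1, ψ ≫ ψ' ≫ p.2⟩
      rw [assoc]))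

/-- The evaluation map of the cotensor. -/
def cotensorEv : ((sModTensor R).obj (cotensor K B)).obj K ⟶ B where
  app n := ModTensorAb.desc (AddMonoidHom.mk' (fun k => ModuleCat.ofHom
    { toFun f := f.1 ⟨n, 𝟙 n⟩ k
      map_add' _ _ := rfl
      map_smul' _ _ := rfl }) fun k k' =>
        ModuleCat.hom_ext (LinearMap.ext fun f => map_add (f.1 ⟨n, 𝟙 n⟩) k k'))
  naturality n m θ := ModTensorAb.hom_ext fun f k => by
    refine Eq.trans ?_ (f.2 (𝟙 n) θ k)
    change f.1 ⟨m, θ ≫ 𝟙 m⟩ (K.map θ k) = f.1 ⟨m, 𝟙 n ≫ θ⟩ (K.map θ k)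
    rw [comp_id, id_comp]

variable {K B} in
/-- The map to the cotensor associated with a map out of a tensor product. -/
def cotensorLift {Y : SimplicialObject (ModuleCat.{u} R)} (g : ((sModTensor R).obj Y).obj K ⟶ B) :
    Y ⟶ cotensor K B where
  app n := ModuleCat.ofHom
    { toFun y := ⟨fun p => AddMonoidHom.mk' (fun k => (g.app p.1).hom (Y.map p.2 y ⊗ₜ[ℤ] k))
        fun k k' => (congrArg (g.app p.1).hom (TensorProduct.tmul_add _ k k')).trans
          (map_add (g.app p.1).hom _ _), fun {m q} φ θ k => by
            change (g.app q).hom (Y.map (φ ≫ θ) y ⊗ₜ[ℤ] K.map θ k) = _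
            rw [Y.map_comp]
            exact ConcreteCategory.congr_hom (g.naturality θ) (Y.map φ y ⊗ₜ[ℤ] k)⟩
      map_add' y y' := Subtype.ext (funext fun p => AddMonoidHom.ext fun k => by
        change (g.app p.1).hom (Y.map p.2 (y + y') ⊗ₜ[ℤ] k) =
          (g.app p.1).hom (Y.map p.2 y ⊗ₜ[ℤ] k) + (g.app p.1).hom (Y.map p.2 y' ⊗ₜ[ℤ] k)
        rw [map_add]
        exact (congrArg (g.app p.1).hom (TensorProduct.add_tmul _ _ k)).trans
          (map_add (g.app p.1).hom _ _))
      map_smul' r y := Subtype.ext (funext fun p => AddMonoidHom.ext fun k => by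
        change (g.app p.1).hom (Y.map p.2 (r • y) ⊗ₜ[ℤ] k) =
          r • (g.app p.1).hom (Y.map p.2 y ⊗ₜ[ℤ] k)
        rw [map_smul]
        exact map_smul (g.app p.1).hom r (Y.map p.2 y ⊗ₜ[ℤ] k)) }
  naturality n m θ := ModuleCat.hom_ext (LinearMap.ext fun y => Subtype.ext (funext fun p =>
    AddMonoidHom.ext fun k => by
      change (g.app p.1).hom (Y.map p.2 (Y.map θ y) ⊗ₜ[ℤ] k) =
        (g.app p.1).hom (Y.map (θ ≫ p.2) y ⊗ₜ[ℤ] k)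
      rw [Y.map_comp]
      rfl))

/-- The universal property of the cotensor. -/
def cotensorEquiv (Y : SimplicialObject (ModuleCat.{u} R)) :
    (Y ⟶ cotensor K B) ≃ (((sModTensor R).obj Y).obj K ⟶ B) where
  toFun y := ((sModTensor R).map y).app K ≫ cotensorEv K B
  invFun g := cotensorLift g
  left_inv y := by
    refine NatTrans.ext (funext fun n => ModuleCat.hom_ext (LinearMap.ext fun a => Subtype.ext
      (funext fun p => AddMonoidHom.ext fun k => ?_)))
    change ((y.app p.1).hom (Y.map p.2 a)).1 ⟨p.1, 𝟙 p.1⟩ k = ((y.app n).hom a).1 p k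
    have h := ConcreteCategory.congr_hom (y.naturality p.2) a
    refine (congrArg (fun f : cotensorFamilies K B p.1 => f.1 ⟨p.1, 𝟙 p.1⟩ k) h).trans ?_
    change ((y.app n).hom a).1 ⟨p.1, p.2 ≫ 𝟙 p.1⟩ k = _
    rw [comp_id]
  right_inv g := by
    refine sTensor_hom_ext (R := R) fun n a k => ?_
    change (g.app n).hom (Y.map (𝟙 n) a ⊗ₜ[ℤ] k) = _
    rw [Y.map_id]
    rfl

/-- By Yoneda, both sides tested on `L` classify maps `(A ⊗ L) ⊗ K ⟶ B`. The braiding occurs because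
the comparison curries `K` first, whereas `K` is the second factor here. -/
theorem isIso_cotensorComparison (A : SimplicialObject (ModuleCat.{u} R)) :
    IsIso (cotensorComparison (SimplicialObject AddCommGrpCat.{u}) (curry (cotensorEv K B)) A) := by
  refine isIso_of_yoneda_map_bijective _ fun L => ?_
  have h : (fun x : L ⟶ sHom A (cotensor K B) =>
      x ≫ cotensorComparison (SimplicialObject AddCommGrpCat.{u}) (curry (cotensorEv K B)) A) =
      MonoidalClosed.curry ∘ (uncurryEquiv (K ⊗ L) A B).symm ∘
        fun x => ((sModTensor R).obj A).map (β_ K L).hom ≫ (assocIso A L K).inv ≫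
          ((sModTensor R).map (uncurry x)).app K ≫ cotensorEv K B := by
    funext x
    dsimp only [Function.comp_apply]
    -- Writing the evaluation map as an uncurried map lets `uncurry_eComp` recognize enriched
    -- composition.
    nth_rw 2 [← uncurry_curry (cotensorEv K B)]
    rw [← uncurry_eComp, ← uncurry_comp]
    refine Eq.trans ?_ (congrArg _ ((uncurryEquiv (K ⊗ L) A B).symm_apply_apply _).symm)
    rw [cotensorComparison, ← MonoidalClosed.curry_natural_left, MonoidalCategory.tensorHom_def, assoc,
      BraidedCategory.braiding_naturality_right_assoc]
  rw [h]
  exact ((ihom.adjunction _).homEquiv _ _).bijective.comp ((Equiv.bijective _).comp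
    ((((sModTensor R).obj A).mapIso (β_ K L).symm).homFromEquiv.bijective.comp
      ((assocIso A L K).homFromEquiv.bijective.comp
        ((cotensorEquiv K B _).bijective.comp (uncurryEquiv L A _).bijective))))

variable (R) in
theorem isCotensored : IsCotensored (SimplicialObject AddCommGrpCat.{u})
    (SimplicialObject (ModuleCat.{u} R)) :=
  fun K B => ⟨cotensor K B, curry (cotensorEv K B), isIso_cotensorComparison K B⟩

end Cotensor

variable (R) in
theorem isEnrichedModelCategory :
    ModelClasses.IsEnrichedModelCategory (simplicialHurewicz AddCommGrpCat.{u})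
      (simplicialHurewicz (ModuleCat.{u} R)) (tensoring R) where
  base := simplicialAb_isMonoidalModelCategory
  isModelCategory := simplicialHurewicz_isModelCategory
  isCotensored := isCotensored R
  pushoutProduct := pushoutProductAxiom_degreewise (modTensorAb R)
  unit X Q q _ _ hq := by
    rw [(simplicialHurewicz (ModuleCat.{u} R)).W.cancel_right_of_respectsIso _
      ((tensoring R).ρ X).hom]
    exact degreewise_W_map (modTensorAb R) X q hq

end SModEnriched

end

theorem proposition4p3 :
    (∀ (R : Type u) [Ring R],
      (chainHurewicz (ModuleCat.{u} R)).IsModelCategory ∧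
      (simplicialHurewicz (ModuleCat.{u} R)).IsModelCategory) ∧
    (∀ (R : Type u) [CommRing R],
      (simplicialHurewicz (ModuleCat.{u} R)).IsMonoidalModelCategory) ∧
    (∀ (R : Type u) [Ring R],
      ∃ t : Tensoring (SimplicialObject AddCommGrpCat.{u}) (sModTensor R),
        ModelClasses.IsEnrichedModelCategory (simplicialHurewicz AddCommGrpCat.{u})
          (simplicialHurewicz (ModuleCat.{u} R)) t) :=
  ⟨fun _ _ => ⟨chainHurewicz_isModelCategory, simplicialHurewicz_isModelCategory⟩,
    fun R _ => simplicialMod_isMonoidalModelCategory R,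
    fun R _ => ⟨SModEnriched.tensoring R, SModEnriched.isEnrichedModelCategory R⟩⟩
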